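/- Let $T>0$ and $H>0$ be fixed. For $\varepsilon>0$ let $$\Phi^\varepsilon(x)=\frac{H}{\varepsilon}\Bigl(\tanh\Bigl(\frac{H}{2\varepsilon}(1-x)\Bigr)-1\Bigr),\qquad x\in(0,1).$$ For $\phi_0\in L^2(0,1)$ consider the system $$\phi_t+\phi\,\phi_x-\phi_{xx}=0\ \text{ in }(0,T)\times(0,1),\qquad \phi(t,0)=\phi(t,1)=0\ \text{ for } t\in(0,T),\qquad \phi(0,\cdot)=\phi_0,\qquad (\ast)$$ whose solutions are understood in the weak (variational) sense in the space $X=L^2((0,T);H^1(0,1))\cap \mathcal C^0([0,T];L^2(0,1))$: $\phi\in X$ has zero boundary values for almost every $t$, $\phi(0,\cdot)=\phi_0$, and for all $v\in H^1_0(0,1)$ and $t\in[0,T]$, $$\int_0^1\phi(t)\,v\,dx-\int_0^1\phi_0\,v\,dx+\int_0^t\!\int_0^1\bigl(\phi\,\phi_x\,v+\phi_x\,v_x\bigr)\,dx\,ds=0.$$ (1) For each small $\varepsilon>0$ let $\phi^\varepsilon\in X$ be a solution of $(\ast)$ with $\phi_0=\Phi^\varepsilon$. Then, for every $\delta>0$,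 $$\|\phi^\varepsilon(T,\cdot)\|_{L^2(0,1)}=\mathcal O(\varepsilon^{1-\delta})\quad\text{as }\varepsilon\to0^+.$$ (2) For each small $\varepsilon>0$ let $d^\varepsilon\in L^2(0,1)$ be such that $\Phi^\varepsilon+\frac1\varepsilon d^\varepsilon\le 0$ almost everywhere on $(0,1)$, and assume that $\|d^\varepsilon\|_{L^2(0,1)}=\mathcal O(\varepsilon^3)$ as $\varepsilon\to0^+$. Let $\phi^\varepsilon\in X$ be a solution of $(\ast)$ with $\phi_0=\Phi^\varepsilon+\frac1\varepsilon d^\varepsilon$. Then, again, for every $\delta>0$, $\|\phi^\varepsilon(T,\cdot)\|_{L^2(0,1)}=\mathcal O(\varepsilon^{1-\delta})$ as $\varepsilon\to0^+$. -/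

import Mathlib

open MeasureTheory Set Filter Topology Asymptotics
open scoped ContDiff

noncomputable section

/-- Lebesgue measure on the open interval `(0,1)`. -/
abbrev unitVol : Measure ℝ := volume.restrict (Ioo 0 1)

/-- The Hilbert space `L²(0,1)`, with its usual norm. -/
abbrev L2I : Type := Lp ℝ 2 unitVol

/-- `g` is the distributional derivative of `f` on `(0,1)`: one has `∫ f ψ' = - ∫ g ψ` for every
smooth `ψ` with compact support in `(0,1)`. As `f` and `g` are in `L²(0,1)`, this says that
`f ∈ H¹(0,1)` and `f_x = g`. -/
def HasWeakDeriv (f g : L2I) : Prop :=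
  ∀ ψ : ℝ → ℝ, ContDiff ℝ ∞ ψ → HasCompactSupport ψ → tsupport ψ ⊆ Ioo 0 1 →
    ∫ x in Ioo (0 : ℝ) 1, f x * deriv ψ x = - ∫ x in Ioo (0 : ℝ) 1, g x * ψ x

/-- The boundary values of `f` at `0` and `1` vanish: `f` has a representative that is continuous
on `[0,1]` and vanishes at both ends (every element of `H¹(0,1)` has a unique representative that
is continuous on `[0,1]`, and its traces are the values of that representative). -/
def ZeroTrace (f : L2I) : Prop :=
  ∃ F : ℝ → ℝ, ContinuousOn F (Icc 0 1) ∧ (∀ᵐ x ∂unitVol, f x = F x) ∧ F 0 = 0 ∧ F 1 = 0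

/-- `φ` is a weak solution in `X = L²((0,T); H¹(0,1)) ∩ C⁰([0,T]; L²(0,1))` of
`φ_t + φ φ_x - φ_xx = 0` in `(0,T) × (0,1)`, `φ(t,0) = φ(t,1) = 0`, `φ(0,x) = φ₀(x)`.
Here `φ t` is the element `φ(t,·)` of `L²(0,1)`, and only `t ∈ [0,T]` matters. -/
def IsBurgersSolution (T : ℝ) (φ₀ : ℝ → ℝ) (φ : ℝ → L2I) : Prop :=
  -- `φ ∈ C⁰([0,T]; L²(0,1))`, with initial value `φ₀`
  ContinuousOn φ (Icc 0 T) ∧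
  (∀ᵐ x ∂unitVol, φ 0 x = φ₀ x) ∧
  -- `φ ∈ L²((0,T); H¹(0,1))`, with `φx` its derivative in space
  ∃ φx : ℝ → L2I,
    MemLp φx 2 (volume.restrict (Ioo 0 T)) ∧
    (∀ᵐ t ∂volume.restrict (Ioo 0 T), HasWeakDeriv (φ t) (φx t)) ∧
    -- the Dirichlet boundary condition
    (∀ᵐ t ∂volume.restrict (Ioo 0 T), ZeroTrace (φ t)) ∧
    -- the equation, integrated in time and tested against every `v ∈ H¹₀(0,1)`
    ∀ v vx : L2I, HasWeakDeriv v vx → ZeroTrace v → ∀ t ∈ Icc 0 T,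
      (∫ x in Ioo (0 : ℝ) 1, φ t x * v x) - (∫ x in Ioo (0 : ℝ) 1, φ 0 x * v x)
        + ∫ s in (0 : ℝ)..t, ((∫ x in Ioo (0 : ℝ) 1, φ s x * φx s x * v x)
            + ∫ x in Ioo (0 : ℝ) 1, φx s x * vx x) = 0

/-- The boundary residue `Φ^ε(x) = (H/ε) (tanh (H (1 - x) / (2 ε)) - 1)`. -/
def boundaryResidue (H ε : ℝ) (x : ℝ) : ℝ :=
  H / ε * (Real.tanh (H / (2 * ε) * (1 - x)) - 1)

end

noncomputable section

/-! The proof is the Cole-Hopf transform carried out on potentials, so that no regularity beyond the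
space `X` is needed. Let `A(t,·)` be the primitive of `φ(t,·)` vanishing at `0`. Formally `u =
e^{-A/2}` solves the heat equation up to a term `c(t) u`, with Neumann conditions because `φ`
vanishes at both ends. Dividing by `∫ u` removes `c(t)`, so the normalised moment `∫ u cos(nπx) / ∫
u` is multiplied by `e^{-n²π²T}` between the times `0` and `T` (`PotentialSolution.expMean_eq`). The
weak formulation gives this directly: the gradient of such a moment with respect to `A` has zero
mean, so its primitive lies in `H¹₀` and is an admissible test function; `burgersForm_meanDensity`
evaluates the equation on it.

At time `T` the moments are the coefficients of a rapidly convergent cosine series for `Y = u / ∫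
u`. If the moments with `n ≠ 0` are `O(η)` initially, then `Y - 1` and `Y_x` are `O(η)` uniformly,
and so is `φ = -2 Y_x / Y` (`norm_le_of_expMean_le`).

It remains to take `η = O(ε)`. The residue has height of order `1/ε` but lives in a layer of width
of order `ε`: its primitive is at most `2 e^{H(x-1)/ε}`, which is bounded and has `L¹` norm `O(ε)`.
The perturbation moves the primitive by at most `‖d‖/ε = O(ε²)`
(`integral_abs_exp_primitive_sub_one_le`). The resulting rate `O(ε)` is stronger than `O(ε^{1-δ})`.
-/

instance unitVol_isProbabilityMeasure : IsProbabilityMeasure unitVol :=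
  ⟨by simp [unitVol]⟩

/-! ### Primitives of `L²` functions on `(0,1)`. -/

/-- Extension by zero of an element of `L²(0,1)`. -/
def zeroExt (f : L2I) : ℝ → ℝ := (Ioo (0 : ℝ) 1).indicator f

/-- The primitive of `f` vanishing at `0`. -/
def primitive (f : L2I) (x : ℝ) : ℝ := ∫ y in (0 : ℝ)..x, zeroExt f y

lemma setIntegral_Ioo_eq (g : ℝ → ℝ) :
    ∫ x in Ioo (0 : ℝ) 1, g x = ∫ x in (0 : ℝ)..1, g x := by
  rw [intervalIntegral.integral_of_le zero_le_one, integral_Ioc_eq_integral_Ioo]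

lemma integrable_coe (f : L2I) : Integrable f unitVol :=
  (Lp.memLp f).integrable one_le_two

lemma integrable_zeroExt (f : L2I) : Integrable (zeroExt f) := by
  rw [zeroExt, integrable_indicator_iff measurableSet_Ioo]
  exact integrable_coe f

lemma zeroExt_eq {f : L2I} {x : ℝ} (hx : x ∈ Ioo (0 : ℝ) 1) : zeroExt f x = f x :=
  indicator_of_mem hx _

lemma ae_unitVol_iff {p : ℝ → Prop} :
    (∀ᵐ x ∂unitVol, p x) ↔ ∀ᵐ x, x ∈ Ioo (0 : ℝ) 1 → p x :=
  ae_restrict_iff' measurableSet_Ioo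

lemma integral_norm_le (f : L2I) : ∫ x, |f x| ∂unitVol ≤ ‖f‖ := by
  have h1 : eLpNorm f 1 unitVol ≤ eLpNorm f 2 unitVol :=
    eLpNorm_le_eLpNorm_of_exponent_le one_le_two (Lp.aestronglyMeasurable f)
  have h2 : ∫ x, |f x| ∂unitVol = (eLpNorm f 1 unitVol).toReal := by
    rw [eLpNorm_one_eq_lintegral_enorm, ← integral_norm_eq_lintegral_enorm
      (Lp.aestronglyMeasurable f)]
    rfl
  rw [h2, Lp.norm_def]
  exact ENNReal.toReal_mono (Lp.eLpNorm_ne_top f) h1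

lemma abs_primitive_le (f : L2I) (x : ℝ) : |primitive f x| ≤ ‖f‖ := by
  calc |primitive f x| ≤ ∫ y in uIoc (0 : ℝ) x, |zeroExt f y| :=
        intervalIntegral.norm_integral_le_integral_norm_uIoc (f := zeroExt f) (μ := volume)
    _ ≤ ∫ y, |zeroExt f y| :=
        setIntegral_le_integral (integrable_zeroExt f).abs (ae_of_all _ fun _ => abs_nonneg _)
    _ = ∫ y, |f y| ∂unitVol := by
        rw [← integral_indicator measurableSet_Ioo]
        congr 1; ext y
        by_cases hy : y ∈ Ioo (0 : ℝ) 1 <;> simp [zeroExt, hy, indicator]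
    _ ≤ ‖f‖ := integral_norm_le f

lemma primitive_congr {f : L2I} {g : ℝ → ℝ} (h : ∀ᵐ x ∂unitVol, f x = g x) {x : ℝ}
    (hx : x ∈ Icc (0 : ℝ) 1) : primitive f x = ∫ y in (0 : ℝ)..x, g y := by
  apply intervalIntegral.integral_congr_ae
  -- The interval integral runs over `(0,x]`, which contains the endpoint `1` when `x = 1`.
  filter_upwards [ae_unitVol_iff.1 h, (by simp [ae_iff] : ∀ᵐ y : ℝ, y ≠ 1)] with y hy hy1 hyx
  rw [uIoc_of_le hx.1] at hyx
  have : y ∈ Ioo (0 : ℝ) 1 := ⟨hyx.1, lt_of_le_of_ne (hyx.2.trans hx.2) hy1⟩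
  rw [zeroExt_eq this, hy this]

lemma primitive_sub (f g : L2I) (x : ℝ) :
    primitive (f - g) x = primitive f x - primitive g x := by
  rw [primitive, primitive, primitive, ← intervalIntegral.integral_sub
    (integrable_zeroExt f).intervalIntegrable (integrable_zeroExt g).intervalIntegrable]
  apply intervalIntegral.integral_congr_ae
  filter_upwards [ae_unitVol_iff.1 (Lp.coeFn_sub f g)] with y hy _
  by_cases h : y ∈ Ioo (0 : ℝ) 1
  · rw [zeroExt_eq h, zeroExt_eq h, zeroExt_eq h, hy h]; rfl
  · simp [zeroExt, h]

lemma abs_primitive_sub_le (f g : L2I) (x : ℝ) :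
    |primitive f x - primitive g x| ≤ ‖f - g‖ := by
  rw [← primitive_sub]; exact abs_primitive_le _ _

@[simp] lemma primitive_zero (f : L2I) : primitive f 0 = 0 := by simp [primitive]

@[fun_prop] lemma continuous_primitive (f : L2I) : Continuous (primitive f) :=
  intervalIntegral.continuous_primitive (fun _ _ => (integrable_zeroExt f).intervalIntegrable) 0

/-- Derivatives in space are only `L²`, so the integrations by parts below rely on absolute
continuity and an almost everywhere derivative. -/
lemma absolutelyContinuous_primitive (f : L2I) :
    AbsolutelyContinuousOnInterval (primitive f) 0 1 :=
  (integrable_zeroExt f).intervalIntegrable.absolutelyContinuousOnInterval_intervalIntegral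
    (by simp)

lemma ae_hasDerivAt_primitive (f : L2I) :
    ∀ᵐ x ∂unitVol, HasDerivAt (primitive f) (f x) x := by
  rw [ae_unitVol_iff]
  filter_upwards [LocallyIntegrable.ae_hasDerivAt_integral
    (integrable_zeroExt f).locallyIntegrable] with x hx h
  rw [← zeroExt_eq h]
  exact hx 0

/-- If `F` is absolutely continuous on `[0,1]` with a.e. derivative `G`, then
`∫₀¹ G = F 1 - F 0`. -/
lemma integral_eq_sub_of_absolutelyContinuous {F G : ℝ → ℝ}
    (hF : AbsolutelyContinuousOnInterval F 0 1) (h : ∀ᵐ x ∂unitVol, HasDerivAt F (G x) x) :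
    ∫ x in Ioo (0 : ℝ) 1, G x = F 1 - F 0 := by
  rw [← hF.integral_deriv_eq_sub, ← setIntegral_Ioo_eq]
  exact integral_congr_ae (h.mono fun x hx => hx.deriv.symm)

lemma absolutelyContinuous_of_hasDerivAt {F G : ℝ → ℝ} (h : ∀ x, HasDerivAt F (G x) x)
    (hG : Continuous G) : AbsolutelyContinuousOnInterval F 0 1 := by
  refine ContDiffOn.absolutelyContinuousOnInterval (ContDiff.contDiffOn ?_)
  rw [contDiff_one_iff_deriv]
  refine ⟨fun x => (h x).differentiableAt, ?_⟩
  rwa [show deriv F = G from funext fun x => (h x).deriv]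

/-! ### Integrals of products with a continuous weight. -/

lemma memLp_mul_bdd (f : L2I) {w : ℝ → ℝ} (hw : Continuous w) :
    MemLp (fun x => f x * w x) 2 unitVol := by
  obtain ⟨C, hC⟩ := isCompact_Icc.exists_bound_of_continuousOn (s := Icc (0:ℝ) 1) hw.continuousOn
  refine (Lp.memLp f).of_le_mul (c := C)
    ((Lp.aestronglyMeasurable f).mul hw.aestronglyMeasurable) ?_
  rw [ae_unitVol_iff]
  refine ae_of_all _ fun x hx => ?_
  rw [norm_mul, mul_comm]
  exact mul_le_mul_of_nonneg_right (hC x (Ioo_subset_Icc_self hx)) (norm_nonneg _)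

lemma integrable_mul_mul (f g : L2I) {w : ℝ → ℝ} (hw : Continuous w) :
    Integrable (fun x => f x * g x * w x) unitVol := by
  have := (Lp.memLp f).integrable_mul (memLp_mul_bdd g hw)
  exact this.congr (ae_of_all _ fun x => by simp [mul_assoc])

lemma integrable_mul (f : L2I) {w : ℝ → ℝ} (hw : Continuous w) :
    Integrable (fun x => f x * w x) unitVol :=
  (memLp_mul_bdd f hw).integrable one_le_two

lemma abs_integral_mul_le (f : L2I) {w : ℝ → ℝ} {C : ℝ}
    (hC : ∀ x ∈ Icc (0 : ℝ) 1, |w x| ≤ C) :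
    |∫ x in Ioo (0 : ℝ) 1, f x * w x| ≤ C * ‖f‖ := by
  have hC0 : 0 ≤ C := (abs_nonneg _).trans (hC 0 (by simp))
  calc |∫ x in Ioo (0 : ℝ) 1, f x * w x| ≤ ∫ x, C * |f x| ∂unitVol := by
        rw [← Real.norm_eq_abs]
        refine norm_integral_le_of_norm_le ((integrable_coe f).abs.const_mul C) ?_
        rw [ae_unitVol_iff]
        refine ae_of_all _ fun x hx => ?_
        rw [Real.norm_eq_abs, abs_mul, mul_comm]
        exact mul_le_mul_of_nonneg_right (hC x (Ioo_subset_Icc_self hx)) (abs_nonneg _)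
    _ = C * ∫ x, |f x| ∂unitVol := integral_const_mul _ _
    _ ≤ C * ‖f‖ := mul_le_mul_of_nonneg_left (integral_norm_le f) hC0

lemma integral_abs_mul_abs_le (f g : L2I) : ∫ x, |f x| * |g x| ∂unitVol ≤ ‖f‖ * ‖g‖ := by
  -- Cauchy-Schwarz for the lattice absolute values keeps the absolute values inside the integral.
  have h := real_inner_le_norm |f| |g|
  rw [norm_abs_eq_norm, norm_abs_eq_norm] at h
  refine le_trans (le_of_eq ?_) h
  rw [L2.inner_def]
  refine integral_congr_ae ?_
  filter_upwards [Lp.coeFn_abs f, Lp.coeFn_abs g] with x hf hg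
  simp [hf, hg, mul_comm]

lemma abs_integral_mul_mul_le (f g : L2I) {w : ℝ → ℝ} {C : ℝ}
    (hC : ∀ x ∈ Icc (0 : ℝ) 1, |w x| ≤ C) :
    |∫ x in Ioo (0 : ℝ) 1, f x * g x * w x| ≤ C * (‖f‖ * ‖g‖) := by
  have hC0 : 0 ≤ C := (abs_nonneg _).trans (hC 0 (by simp))
  have hi : Integrable (fun x => |f x| * |g x|) unitVol :=
    ((Lp.memLp f).integrable_mul (Lp.memLp g)).abs.congr (ae_of_all _ fun x => by simp [abs_mul])
  calc |∫ x in Ioo (0 : ℝ) 1, f x * g x * w x| ≤ ∫ x, C * (|f x| * |g x|) ∂unitVol := by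
        rw [← Real.norm_eq_abs]
        refine norm_integral_le_of_norm_le (hi.const_mul C) ?_
        rw [ae_unitVol_iff]
        refine ae_of_all _ fun x hx => ?_
        rw [Real.norm_eq_abs, abs_mul, abs_mul, mul_comm]
        exact mul_le_mul_of_nonneg_right (hC x (Ioo_subset_Icc_self hx)) (by positivity)
    _ = C * ∫ x, |f x| * |g x| ∂unitVol := integral_const_mul _ _
    _ ≤ C * (‖f‖ * ‖g‖) := mul_le_mul_of_nonneg_left (integral_abs_mul_abs_le f g) hC0

/-! ### Test functions and the description of `H¹₀(0,1)` by primitives. -/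

lemma hasDerivAt_of_contDiff {ψ : ℝ → ℝ} (hψ : ContDiff ℝ ∞ ψ) (x : ℝ) :
    HasDerivAt ψ (deriv ψ x) x :=
  (hψ.differentiable (by simp) x).hasDerivAt

lemma continuous_deriv_of_contDiff {ψ : ℝ → ℝ} (hψ : ContDiff ℝ ∞ ψ) : Continuous (deriv ψ) :=
  hψ.continuous_deriv (by simp)

lemma eq_zero_of_tsupport_subset {ψ : ℝ → ℝ} {s : Set ℝ} (h : tsupport ψ ⊆ s) {x : ℝ}
    (hx : x ∉ s) : ψ x = 0 :=
  image_eq_zero_of_notMem_tsupport fun h' => hx (h h')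

/-- Integration by parts of the primitive of an `L²` function against a test function. -/
lemma integral_primitive_mul_deriv (g : L2I) {ψ : ℝ → ℝ} (hψ : ContDiff ℝ ∞ ψ)
    (hs : tsupport ψ ⊆ Ioo 0 1) :
    ∫ x in Ioo (0 : ℝ) 1, primitive g x * deriv ψ x = - ∫ x in Ioo (0 : ℝ) 1, g x * ψ x := by
  have hψc := hψ.continuous
  have hψd := continuous_deriv_of_contDiff hψ
  have h := integral_eq_sub_of_absolutelyContinuous
    (F := fun x => primitive g x * ψ x) (G := fun x => g x * ψ x + primitive g x * deriv ψ x)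
    ((absolutelyContinuous_primitive g).fun_mul
      (absolutelyContinuous_of_hasDerivAt (hasDerivAt_of_contDiff hψ) hψd))
    ((ae_hasDerivAt_primitive g).mono fun x hx => hx.mul (hasDerivAt_of_contDiff hψ x))
  rw [integral_add (integrable_mul g hψc), eq_zero_of_tsupport_subset hs (x := 1) (by simp),
    eq_zero_of_tsupport_subset hs (x := 0) (by simp)] at h
  · linarith
  · exact ((continuous_primitive g).mul hψd).integrableOn_Icc.mono_set Ioo_subset_Icc_self

lemma exists_tsupport_subset_Icc {θ : ℝ → ℝ} (hc : HasCompactSupport θ)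
    (hs : tsupport θ ⊆ Ioo 0 1) : ∃ a > (0 : ℝ), ∃ b < (1 : ℝ), tsupport θ ⊆ Icc a b := by
  rcases (tsupport θ).eq_empty_or_nonempty with h | h
  · exact ⟨1 / 2, by norm_num, 1 / 2, by norm_num, by simp [h]⟩
  · obtain ⟨a, ha, ha'⟩ := IsCompact.exists_isLeast hc h
    obtain ⟨b, hb, hb'⟩ := IsCompact.exists_isGreatest hc h
    exact ⟨a, (hs ha).1, b, (hs hb).2, fun x hx => ⟨ha' hx, hb' hx⟩⟩

/-- A test function with zero mean is the derivative of a test function. -/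
lemma exists_testFunction_deriv_eq {θ : ℝ → ℝ} (hθ : ContDiff ℝ ∞ θ) (hc : HasCompactSupport θ)
    (hs : tsupport θ ⊆ Ioo 0 1) (h0 : ∫ x in (0 : ℝ)..1, θ x = 0) :
    ∃ ψ : ℝ → ℝ, ContDiff ℝ ∞ ψ ∧ HasCompactSupport ψ ∧ tsupport ψ ⊆ Ioo 0 1 ∧
      deriv ψ = θ := by
  obtain ⟨a, ha, b, hb, hab⟩ := exists_tsupport_subset_Icc hc hs
  have hder : ∀ x, HasDerivAt (fun x => ∫ y in (0 : ℝ)..x, θ y) (θ x) x := fun x =>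
    intervalIntegral.integral_hasDerivAt_right (hθ.continuous.intervalIntegrable _ _)
      hθ.continuous.stronglyMeasurable.stronglyMeasurableAtFilter hθ.continuous.continuousAt
  have hd : deriv (fun x => ∫ y in (0 : ℝ)..x, θ y) = θ := funext fun x => (hder x).deriv
  have hsub : tsupport (fun x => ∫ y in (0 : ℝ)..x, θ y) ⊆ Icc a b := by
    refine closure_minimal (fun x hx => ?_) isClosed_Icc
    by_contra hx'
    refine hx ?_
    by_cases hxa : x < a
    · refine (intervalIntegral.integral_congr (g := fun _ => 0) fun y hy => ?_).trans (by simp)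
      refine eq_zero_of_tsupport_subset hab fun h => ?_
      have := hy.2
      have := h.1
      have := max_lt ha hxa
      linarith
    · have hxb : b < x := by
        by_contra h; exact hx' ⟨not_lt.1 hxa, not_lt.1 h⟩
      -- To the right of the support, zero mean gives `∫₀ˣ θ = -∫ₓ¹ θ`, and the latter integrand
      -- vanishes.
      have h1 : ∫ y in x..1, θ y = 0 := by
        refine (intervalIntegral.integral_congr (g := fun _ => 0) fun y hy => ?_).trans (by simp)
        refine eq_zero_of_tsupport_subset hab fun h => ?_
        have := hy.1
        have := h.2
        have := lt_min hxb hb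
        linarith
      have h2 := intervalIntegral.integral_add_adjacent_intervals
        (hθ.continuous.intervalIntegrable (μ := volume) 0 x)
        (hθ.continuous.intervalIntegrable (μ := volume) x 1)
      simp only
      linarith
  refine ⟨_, ?_, HasCompactSupport.of_support_subset_isCompact isCompact_Icc
    ((subset_tsupport _).trans hsub), hsub.trans (Icc_subset_Ioo ha hb), hd⟩
  rw [contDiff_infty_iff_deriv, hd]
  exact ⟨fun x => (hder x).differentiableAt, hθ⟩

lemma exists_testFunction_integral_eq_one : ∃ χ : ℝ → ℝ, ContDiff ℝ ∞ χ ∧ HasCompactSupport χ ∧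
    tsupport χ ⊆ Ioo 0 1 ∧ ∫ x in (0 : ℝ)..1, χ x = 1 := by
  let f : ContDiffBump (1 / 2 : ℝ) := ⟨1 / 8, 1 / 4, by norm_num, by norm_num⟩
  have hs : tsupport (f.normed volume) ⊆ Ioo 0 1 := by
    rw [f.tsupport_normed_eq]
    intro x hx
    have : dist x (1 / 2) ≤ 1 / 4 := Metric.mem_closedBall.1 hx
    rw [Real.dist_eq, abs_le] at this
    constructor <;> linarith
  refine ⟨f.normed volume, f.contDiff_normed, f.hasCompactSupport_normed, hs, ?_⟩
  rw [← setIntegral_Ioo_eq, setIntegral_eq_integral_of_forall_compl_eq_zero, f.integral_normed]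
  exact fun x hx => eq_zero_of_tsupport_subset hs hx

/-- **Du Bois-Reymond**: an integrable function on `(0,1)` with vanishing distributional
derivative is constant. -/
lemma exists_ae_eq_const {r : ℝ → ℝ} (hr : Integrable r unitVol)
    (h : ∀ ψ : ℝ → ℝ, ContDiff ℝ ∞ ψ → HasCompactSupport ψ → tsupport ψ ⊆ Ioo 0 1 →
      ∫ x in Ioo (0 : ℝ) 1, r x * deriv ψ x = 0) :
    ∃ c : ℝ, ∀ᵐ x ∂unitVol, r x = c := by
  have hint : ∀ θ : ℝ → ℝ, Continuous θ → Integrable (fun x => r x * θ x) unitVol := by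
    intro θ hθ
    obtain ⟨C, hC⟩ := isCompact_Icc.exists_bound_of_continuousOn (s := Icc (0:ℝ) 1)
      hθ.continuousOn
    refine hr.mul_bdd hθ.aestronglyMeasurable (c := C) ?_
    rw [ae_unitVol_iff]
    exact ae_of_all _ fun x hx => hC x (Ioo_subset_Icc_self hx)
  obtain ⟨χ, hχ, hχc, hχs, hχ1⟩ := exists_testFunction_integral_eq_one
  refine ⟨∫ x in Ioo (0 : ℝ) 1, r x * χ x, ?_⟩
  set c := ∫ x in Ioo (0 : ℝ) 1, r x * χ x with hcdef
  have key : ∀ᵐ x, x ∈ Ioo (0 : ℝ) 1 → r x - c = 0 := by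
    refine isOpen_Ioo.ae_eq_zero_of_integral_contDiff_smul_eq_zero
      (IntegrableOn.locallyIntegrableOn (hr.sub (integrable_const c))) fun θ hθ hθc hθs => ?_
    -- Subtracting `(∫ θ) χ` makes an arbitrary test function `θ` mean-free, hence a derivative of a
    -- test function.
    have hcχ : ContDiff ℝ ∞ fun x => (∫ y in (0 : ℝ)..1, θ y) * χ x := contDiff_const.mul hχ
    obtain ⟨ψ, hψ, hψc, hψs, hψd⟩ := exists_testFunction_deriv_eq
      (θ := θ - fun x => (∫ y in (0 : ℝ)..1, θ y) * χ x) (hθ.sub hcχ)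
      (hθc.sub (hχc.mul_left)) ((tsupport_sub _ _).trans (union_subset hθs
        ((tsupport_mul_subset_right).trans hχs))) (by
        simp only [Pi.sub_apply]
        rw [intervalIntegral.integral_sub (hθ.continuous.intervalIntegrable _ _)
          (hcχ.continuous.intervalIntegrable _ _), intervalIntegral.integral_const_mul, hχ1]
        ring)
    have h1 := h ψ hψ hψc hψs
    rw [hψd] at h1
    have h2 : ∫ x in Ioo (0 : ℝ) 1, r x * (θ x - (∫ y in (0 : ℝ)..1, θ y) * χ x)
        = (∫ x in Ioo (0 : ℝ) 1, r x * θ x) - (∫ y in (0 : ℝ)..1, θ y) * c := by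
      rw [hcdef, ← integral_const_mul, ← integral_sub (hint θ hθ.continuous)
        ((hint χ hχ.continuous).const_mul _)]
      congr 1; ext x; ring
    simp only [Pi.sub_apply] at h1
    rw [h2] at h1
    rw [← setIntegral_eq_integral_of_forall_compl_eq_zero (s := Ioo (0 : ℝ) 1) fun x hx => by
      rw [eq_zero_of_tsupport_subset hθs hx, zero_smul]]
    have h3 : ∫ x in Ioo (0 : ℝ) 1, θ x • (r x - c)
        = (∫ x in Ioo (0 : ℝ) 1, r x * θ x) - c * ∫ x in Ioo (0 : ℝ) 1, θ x := by
      rw [← integral_const_mul, ← integral_sub (hint θ hθ.continuous)]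
      · congr 1; ext x; simp; ring
      · exact ((hθ.continuous.integrable_of_hasCompactSupport hθc).integrableOn).const_mul c
    rw [h3, setIntegral_Ioo_eq θ]
    linarith
  rw [ae_unitVol_iff]
  filter_upwards [key] with x hx hx'
  linarith [hx hx']

/-- An element of `H¹₀(0,1)` is the primitive of its weak derivative. -/
lemma HasWeakDeriv.eq_primitive {f g : L2I} (h : HasWeakDeriv f g) (h0 : ZeroTrace f) :
    (∀ᵐ x ∂unitVol, f x = primitive g x) ∧ primitive g 1 = 0 := by
  have hpi : ∀ θ : ℝ → ℝ, Continuous θ → Integrable (fun x => primitive g x * θ x) unitVol :=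
    fun θ hθ => ((continuous_primitive g).mul hθ).integrableOn_Icc.mono_set Ioo_subset_Icc_self
  have hp1 : Integrable (primitive g) unitVol :=
    (continuous_primitive g).integrableOn_Icc.mono_set Ioo_subset_Icc_self
  obtain ⟨c, hc⟩ := exists_ae_eq_const ((integrable_coe f).sub hp1) (by
    intro ψ hψ hψc hψs
    have hd := continuous_deriv_of_contDiff hψ
    have h1 := h ψ hψ hψc hψs
    rw [← integral_primitive_mul_deriv g hψ hψs] at h1
    have h2 : ∫ x in Ioo (0 : ℝ) 1, (f x - primitive g x) * deriv ψ x
        = (∫ x in Ioo (0 : ℝ) 1, f x * deriv ψ x)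
          - ∫ x in Ioo (0 : ℝ) 1, primitive g x * deriv ψ x := by
      rw [← integral_sub (integrable_mul f hd) (hpi _ hd)]
      congr 1; ext x; ring
    simp only [Pi.sub_apply]
    rw [h2, h1, sub_self])
  obtain ⟨F, hF, hfF, hF0, hF1⟩ := h0
  have hae : F =ᵐ[volume.restrict (Icc 0 1)] fun x => primitive g x + c := by
    rw [← restrict_Ioo_eq_restrict_Icc]
    filter_upwards [hc, hfF] with x h1 h2
    simp only [Pi.sub_apply] at h1
    rw [← h2]; linarith
  -- Two functions continuous on `[0,1]` that agree almost everywhere agree at the ends: the value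
  -- at `0` gives `c = 0`, the value at `1` then gives `primitive g 1 = 0`.
  have heq := Measure.eqOn_Icc_of_ae_eq volume zero_ne_one hae hF (by fun_prop)
  have e0 := heq (x := 0) (by simp)
  have e1 := heq (x := 1) (by simp)
  simp only [hF0, primitive_zero, hF1] at e0 e1
  refine ⟨hc.mono fun x hx => ?_, by linarith⟩
  simp only [Pi.sub_apply] at hx
  linarith

/-! ### The Burgers form tested against primitives of continuous functions. -/

lemma memLp_of_continuous {h : ℝ → ℝ} (hh : Continuous h) : MemLp h 2 unitVol := by
  obtain ⟨C, hC⟩ := isCompact_Icc.exists_bound_of_continuousOn (s := Icc (0:ℝ) 1) hh.continuousOn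
  refine MemLp.of_bound hh.aestronglyMeasurable C ?_
  rw [ae_unitVol_iff]
  exact ae_of_all _ fun x hx => hC x (Ioo_subset_Icc_self hx)

/-- The primitive of a continuous function, vanishing at `0`. -/
def integralFromZero (h : ℝ → ℝ) (x : ℝ) : ℝ := ∫ y in (0 : ℝ)..x, h y

lemma hasDerivAt_integralFromZero {h : ℝ → ℝ} (hh : Continuous h) (x : ℝ) :
    HasDerivAt (integralFromZero h) (h x) x :=
  intervalIntegral.integral_hasDerivAt_right (hh.intervalIntegrable _ _)
      hh.stronglyMeasurable.stronglyMeasurableAtFilter hh.continuousAt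

lemma continuous_integralFromZero {h : ℝ → ℝ} (hh : Continuous h) :
    Continuous (integralFromZero h) :=
  continuous_iff_continuousAt.2 fun x => (hasDerivAt_integralFromZero hh x).continuousAt

lemma abs_integralFromZero_le {h : ℝ → ℝ} {C : ℝ}
    (hC : ∀ x ∈ Icc (0 : ℝ) 1, |h x| ≤ C) {x : ℝ} (hx : x ∈ Icc (0 : ℝ) 1) :
    |integralFromZero h x| ≤ C := by
  have hC0 : 0 ≤ C := (abs_nonneg _).trans (hC 0 (by simp))
  have := intervalIntegral.norm_integral_le_of_norm_le_const (a := 0) (b := x) (f := h) (C := C)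
    (fun y hy => by
      rw [uIoc_of_le hx.1] at hy
      exact hC y ⟨hy.1.le, hy.2.trans hx.2⟩)
  rw [sub_zero, abs_of_nonneg hx.1] at this
  exact this.trans (mul_le_of_le_one_right hC0 hx.2)

/-- The primitive of a continuous function with zero mean belongs to `H¹₀(0,1)`. -/
lemma hasWeakDeriv_integralFromZero {h : ℝ → ℝ} (hh : Continuous h)
    (h0 : ∫ x in (0 : ℝ)..1, h x = 0) :
    HasWeakDeriv (memLp_of_continuous (continuous_integralFromZero hh)).toLp
      (memLp_of_continuous hh).toLp ∧
    ZeroTrace (memLp_of_continuous (continuous_integralFromZero hh)).toLp := by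
  have e1 := (memLp_of_continuous (continuous_integralFromZero hh)).coeFn_toLp
  have e2 := (memLp_of_continuous hh).coeFn_toLp
  refine ⟨fun ψ hψ _ hs => ?_, integralFromZero h, (continuous_integralFromZero hh).continuousOn,
    e1, by simp [integralFromZero], h0⟩
  have hp : ∀ x ∈ Icc (0 : ℝ) 1,
      primitive (memLp_of_continuous hh).toLp x = integralFromZero h x := fun x hx =>
    primitive_congr e2 hx
  rw [← integral_primitive_mul_deriv _ hψ hs]
  refine integral_congr_ae ?_
  filter_upwards [e1, ae_unitVol_iff.2 (ae_of_all _ fun x hx => hx)] with x hx hx'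
  rw [hx, hp x (Ioo_subset_Icc_self hx')]

/-- The spatial form of the Burgers equation tested against the primitive of `h`. -/
def burgersForm (f g : L2I) (h : ℝ → ℝ) : ℝ :=
  (∫ x in Ioo (0 : ℝ) 1, f x * g x * integralFromZero h x) + ∫ x in Ioo (0 : ℝ) 1, g x * h x

/-- The bound is linear in `‖g‖`, so along a solution `‖φx‖` serves as an integrable density in
time; it is also linear in the sup norm of `h`, which allows `h` to be replaced by a nearby density.
-/
lemma abs_burgersForm_le (f g : L2I) {h : ℝ → ℝ} {C : ℝ}
    (hC : ∀ x ∈ Icc (0 : ℝ) 1, |h x| ≤ C) :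
    |burgersForm f g h| ≤ C * (‖f‖ * ‖g‖ + ‖g‖) := by
  have h1 := abs_integral_mul_mul_le f g (fun x hx => abs_integralFromZero_le hC hx)
  have h2 := abs_integral_mul_le g hC
  rw [mul_add]
  exact (abs_add_le _ _).trans (add_le_add h1 h2)

lemma burgersForm_sub (f g : L2I) {h k : ℝ → ℝ} (hh : Continuous h) (hk : Continuous k) :
    burgersForm f g (fun x => h x - k x) = burgersForm f g h - burgersForm f g k := by
  have hI : ∀ x, integralFromZero (fun x => h x - k x) x
      = integralFromZero h x - integralFromZero k x := fun x =>
    intervalIntegral.integral_sub (hh.intervalIntegrable _ _) (hk.intervalIntegrable _ _)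
  have h1 : ∫ x in Ioo (0 : ℝ) 1, f x * g x * integralFromZero (fun x => h x - k x) x
      = (∫ x in Ioo (0 : ℝ) 1, f x * g x * integralFromZero h x)
        - ∫ x in Ioo (0 : ℝ) 1, f x * g x * integralFromZero k x := by
    rw [← integral_sub (integrable_mul_mul f g (continuous_integralFromZero hh))
      (integrable_mul_mul f g (continuous_integralFromZero hk))]
    congr 1; ext x; rw [hI]; ring
  have h2 : ∫ x in Ioo (0 : ℝ) 1, g x * (h x - k x)
      = (∫ x in Ioo (0 : ℝ) 1, g x * h x) - ∫ x in Ioo (0 : ℝ) 1, g x * k x := by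
    rw [← integral_sub (integrable_mul g hh) (integrable_mul g hk)]
    congr 1; ext x; ring
  rw [burgersForm, burgersForm, burgersForm, h1, h2]
  ring

lemma exists_bound_Icc {w : ℝ → ℝ} (hw : Continuous w) :
    ∃ C, ∀ x ∈ Icc (0 : ℝ) 1, |w x| ≤ C :=
  isCompact_Icc.exists_bound_of_continuousOn hw.continuousOn

lemma integral_sub_mul (f f' : L2I) {w : ℝ → ℝ} (hw : Continuous w) :
    ∫ x in Ioo (0 : ℝ) 1, (f - f') x * w x
      = (∫ x in Ioo (0 : ℝ) 1, f x * w x) - ∫ x in Ioo (0 : ℝ) 1, f' x * w x := by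
  rw [← integral_sub (integrable_mul f hw) (integrable_mul f' hw)]
  refine integral_congr_ae ?_
  filter_upwards [Lp.coeFn_sub f f'] with x hx
  rw [hx, Pi.sub_apply]; ring

lemma integral_sub_mul_mul (f f' g : L2I) {w : ℝ → ℝ} (hw : Continuous w) :
    ∫ x in Ioo (0 : ℝ) 1, (f - f') x * g x * w x
      = (∫ x in Ioo (0 : ℝ) 1, f x * g x * w x) - ∫ x in Ioo (0 : ℝ) 1, f' x * g x * w x := by
  rw [← integral_sub (integrable_mul_mul f g hw) (integrable_mul_mul f' g hw)]
  refine integral_congr_ae ?_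
  filter_upwards [Lp.coeFn_sub f f'] with x hx
  rw [hx, Pi.sub_apply]; ring

lemma integral_mul_sub_mul (f g g' : L2I) {w : ℝ → ℝ} (hw : Continuous w) :
    ∫ x in Ioo (0 : ℝ) 1, f x * (g - g') x * w x
      = (∫ x in Ioo (0 : ℝ) 1, f x * g x * w x) - ∫ x in Ioo (0 : ℝ) 1, f x * g' x * w x := by
  rw [← integral_sub (integrable_mul_mul f g hw) (integrable_mul_mul f g' hw)]
  refine integral_congr_ae ?_
  filter_upwards [Lp.coeFn_sub g g'] with x hx
  rw [hx, Pi.sub_apply]; ring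

lemma continuous_integral_mul {w : ℝ → ℝ} (hw : Continuous w) :
    Continuous fun f : L2I => ∫ x in Ioo (0 : ℝ) 1, f x * w x := by
  obtain ⟨C, hC⟩ := exists_bound_Icc hw
  refine continuous_iff_continuousAt.2 fun f₀ => ?_
  rw [ContinuousAt, tendsto_iff_norm_sub_tendsto_zero]
  refine squeeze_zero (g := fun f => C * ‖f - f₀‖) (fun _ => norm_nonneg _) (fun f => ?_) ?_
  · rw [← integral_sub_mul _ _ hw]
    exact abs_integral_mul_le _ hC
  · have : Continuous fun f : L2I => C * ‖f - f₀‖ := by fun_prop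
    simpa using this.tendsto f₀

lemma continuous_integral_mul_mul {w : ℝ → ℝ} (hw : Continuous w) :
    Continuous fun p : L2I × L2I => ∫ x in Ioo (0 : ℝ) 1, p.1 x * p.2 x * w x := by
  obtain ⟨C, hC⟩ := exists_bound_Icc hw
  refine continuous_iff_continuousAt.2 fun p₀ => ?_
  rw [ContinuousAt, tendsto_iff_norm_sub_tendsto_zero]
  refine squeeze_zero
    (g := fun p => C * (‖p.1 - p₀.1‖ * ‖p.2‖) + C * (‖p₀.1‖ * ‖p.2 - p₀.2‖))
    (fun _ => norm_nonneg _) (fun p => ?_) ?_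
  · rw [show ((∫ x in Ioo (0 : ℝ) 1, p.1 x * p.2 x * w x)
        - ∫ x in Ioo (0 : ℝ) 1, p₀.1 x * p₀.2 x * w x)
        = (∫ x in Ioo (0 : ℝ) 1, (p.1 - p₀.1) x * p.2 x * w x)
        + ∫ x in Ioo (0 : ℝ) 1, p₀.1 x * (p.2 - p₀.2) x * w x by
          rw [integral_sub_mul_mul _ _ _ hw, integral_mul_sub_mul _ _ _ hw]; ring]
    exact (norm_add_le _ _).trans
      (add_le_add (abs_integral_mul_mul_le _ _ hC) (abs_integral_mul_mul_le _ _ hC))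
  · have : Continuous fun p : L2I × L2I =>
        C * (‖p.1 - p₀.1‖ * ‖p.2‖) + C * (‖p₀.1‖ * ‖p.2 - p₀.2‖) := by fun_prop
    simpa using this.tendsto p₀

/-- Joint continuity yields measurability in time along a solution. -/
lemma continuous_burgersForm {h : ℝ → ℝ} (hh : Continuous h) :
    Continuous fun p : L2I × L2I => burgersForm p.1 p.2 h :=
  (continuous_integral_mul_mul (continuous_integralFromZero hh)).add
    ((continuous_integral_mul hh).comp continuous_snd)

/-- Integration by parts against the primitive of a mean-free function. -/
lemma integral_mul_integralFromZero (f : L2I) {h : ℝ → ℝ} (hh : Continuous h)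
    (h0 : ∫ x in (0 : ℝ)..1, h x = 0) :
    ∫ x in Ioo (0 : ℝ) 1, f x * integralFromZero h x
      = - ∫ x in (0 : ℝ)..1, primitive f x * h x := by
  have h1 := integral_eq_sub_of_absolutelyContinuous
    (F := fun x => primitive f x * integralFromZero h x)
    (G := fun x => f x * integralFromZero h x + primitive f x * h x)
    ((absolutelyContinuous_primitive f).fun_mul
      (absolutelyContinuous_of_hasDerivAt (hasDerivAt_integralFromZero hh) hh))
    ((ae_hasDerivAt_primitive f).mono fun x hx => hx.mul (hasDerivAt_integralFromZero hh x))
  have h2 : integralFromZero h 1 = 0 := h0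
  rw [integral_add (integrable_mul f (continuous_integralFromZero hh)), h2] at h1
  · rw [← setIntegral_Ioo_eq]
    simp at h1
    linarith
  · exact ((continuous_primitive f).mul hh).integrableOn_Icc.mono_set Ioo_subset_Icc_self

/-! ### Weak solutions seen through their potentials. -/

/-- The data of a weak solution, in terms of the primitives of its time slices. -/
structure PotentialSolution (T : ℝ) (φ φx : ℝ → L2I) : Prop where
  continuousOn : ContinuousOn φ (Icc 0 T)
  memLp : MemLp φx 2 (volume.restrict (Ioo 0 T))
  ae_slice : ∀ᵐ t ∂volume.restrict (Ioo 0 T),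
    (∀ᵐ x ∂unitVol, φ t x = primitive (φx t) x) ∧ primitive (φx t) 1 = 0
  equation : ∀ h : ℝ → ℝ, Continuous h → ∫ x in (0 : ℝ)..1, h x = 0 → ∀ t ∈ Icc 0 T,
    ∫ x in (0 : ℝ)..1, (primitive (φ t) x - primitive (φ 0) x) * h x
      = ∫ s in (0 : ℝ)..t, burgersForm (φ s) (φx s) h

lemma IsBurgersSolution.exists_potentialSolution {T : ℝ} {φ₀ : ℝ → ℝ} {φ : ℝ → L2I}
    (hφ : IsBurgersSolution T φ₀ φ) : ∃ φx, PotentialSolution T φ φx := by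
  obtain ⟨hc, -, φx, hL, hw, hz, heq⟩ := hφ
  refine ⟨φx, hc, hL, ?_, fun h hh h0 t ht => ?_⟩
  · filter_upwards [hw, hz] with t h1 h2 using h1.eq_primitive h2
  · obtain ⟨hv, hv0⟩ := hasWeakDeriv_integralFromZero hh h0
    have e1 := (memLp_of_continuous (continuous_integralFromZero hh)).coeFn_toLp
    have e2 := (memLp_of_continuous hh).coeFn_toLp
    set v : L2I := (memLp_of_continuous (continuous_integralFromZero hh)).toLp
    set vx : L2I := (memLp_of_continuous hh).toLp
    have h1 := heq _ _ hv hv0 t ht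
    have h2 : ∀ f : L2I, ∫ x in Ioo (0 : ℝ) 1,
        f x * v x
          = - ∫ x in (0 : ℝ)..1, primitive f x * h x := fun f => by
      rw [← integral_mul_integralFromZero f hh h0]
      refine integral_congr_ae ?_
      filter_upwards [e1] with x hx
      rw [hx]
    have h3 : ∀ s : ℝ, ((∫ x in Ioo (0 : ℝ) 1,
          φ s x * φx s x * v x)
        + ∫ x in Ioo (0 : ℝ) 1, φx s x * vx x)
        = burgersForm (φ s) (φx s) h := fun s => by
      rw [burgersForm]
      congr 1
      · refine integral_congr_ae ?_
        filter_upwards [e1] with x hx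
        rw [hx]
      · refine integral_congr_ae ?_
        filter_upwards [e2] with x hx
        rw [hx]
    simp only [h3] at h1
    rw [h2, h2] at h1
    have hint : ∀ f : L2I, IntervalIntegrable (fun x => primitive f x * h x) volume 0 1 :=
      fun f => ((continuous_primitive f).mul hh).intervalIntegrable _ _
    simp only [sub_mul]
    rw [intervalIntegral.integral_sub (hint _) (hint _)]
    linarith

namespace PotentialSolution

variable {T : ℝ} {φ φx : ℝ → L2I}

lemma exists_bound (hφ : PotentialSolution T φ φx) : ∃ R > 0, ∀ t ∈ Icc 0 T, ‖φ t‖ ≤ R := by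
  obtain ⟨R, hR⟩ := isCompact_Icc.exists_bound_of_continuousOn hφ.continuousOn
  exact ⟨max R 1, by positivity, fun t ht => (hR t ht).trans (le_max_left _ _)⟩

lemma integrable_norm (hφ : PotentialSolution T φ φx) :
    IntegrableOn (fun s => ‖φx s‖) (Ioo 0 T) :=
  (hφ.memLp.integrable one_le_two).norm

lemma integrableOn_burgersForm (hφ : PotentialSolution T φ φx) {h : ℝ → ℝ} (hh : Continuous h) :
    IntegrableOn (fun s => burgersForm (φ s) (φx s) h) (Ioo 0 T) := by
  obtain ⟨R, hR0, hR⟩ := hφ.exists_bound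
  obtain ⟨C, hC⟩ := exists_bound_Icc hh
  have hC0 : 0 ≤ C := (abs_nonneg _).trans (hC 0 (by simp))
  have hm : AEStronglyMeasurable φ (volume.restrict (Ioo 0 T)) :=
    (hφ.continuousOn.mono Ioo_subset_Icc_self).aestronglyMeasurable measurableSet_Ioo
  refine Integrable.mono' (hφ.integrable_norm.const_mul (C * (R + 1)))
    ((continuous_burgersForm hh).comp_aestronglyMeasurable
      (hm.prodMk hφ.memLp.aestronglyMeasurable)) ?_
  rw [ae_restrict_iff' measurableSet_Ioo]
  refine ae_of_all _ fun s hs => (abs_burgersForm_le _ _ hC).trans ?_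
  have := hR s (Ioo_subset_Icc_self hs)
  have : ‖φ s‖ * ‖φx s‖ ≤ R * ‖φx s‖ := by gcongr
  calc C * (‖φ s‖ * ‖φx s‖ + ‖φx s‖) ≤ C * (R * ‖φx s‖ + ‖φx s‖) := by gcongr
    _ = _ := by ring

lemma intervalIntegrable_of_integrableOn {F : ℝ → ℝ} (hF : IntegrableOn F (Ioo 0 T)) {s t : ℝ}
    (hs : s ∈ Icc 0 T) (ht : t ∈ Icc 0 T) : IntervalIntegrable F volume s t := by
  rw [intervalIntegrable_iff]
  refine ((integrableOn_Icc_iff_integrableOn_Ioo).2 hF).mono_set ?_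
  exact uIoc_subset_uIcc.trans (uIcc_subset_Icc hs ht)

lemma equation_sub (hφ : PotentialSolution T φ φx) {h : ℝ → ℝ} (hh : Continuous h)
    (h0 : ∫ x in (0 : ℝ)..1, h x = 0) {s t : ℝ} (hs : s ∈ Icc 0 T) (ht : t ∈ Icc 0 T) :
    ∫ x in (0 : ℝ)..1, (primitive (φ t) x - primitive (φ s) x) * h x
      = ∫ τ in s..t, burgersForm (φ τ) (φx τ) h := by
  have hi := hφ.integrableOn_burgersForm hh
  have h0T : (0 : ℝ) ∈ Icc 0 T := ⟨le_rfl, ht.1.trans ht.2⟩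
  rw [← intervalIntegral.integral_interval_sub_left
    (intervalIntegrable_of_integrableOn hi h0T ht) (intervalIntegrable_of_integrableOn hi h0T hs),
    ← hφ.equation h hh h0 t ht, ← hφ.equation h hh h0 s hs,
    ← intervalIntegral.integral_sub]
  · congr 1; ext x; ring
  all_goals exact Continuous.intervalIntegrable (by fun_prop) _ _

end PotentialSolution

/-! ### Normalised Cole-Hopf moments and their gradients. -/

/-- The moment `∫₀¹ e^{-A/2} k` of the Cole-Hopf transform of the potential `A`. -/
def expMoment (k A : ℝ → ℝ) : ℝ := ∫ x in (0 : ℝ)..1, Real.exp (-(A x) / 2) * k x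

/-- The normalised moment `∫₀¹ e^{-A/2} k / ∫₀¹ e^{-A/2}`, invariant under addition of constants
to `A`. -/
def expMean (k A : ℝ → ℝ) : ℝ := expMoment k A / expMoment (fun _ => 1) A

/-- Up to the factor `-1/2`, the gradient of `A ↦ expMean k A`. -/
def meanDensity (k A : ℝ → ℝ) (x : ℝ) : ℝ :=
  Real.exp (-(A x) / 2) * (k x - expMean k A) / expMoment (fun _ => 1) A

section Moments

variable {k A B D : ℝ → ℝ}

lemma intervalIntegrable_exp_mul (hk : Continuous k) (hA : Continuous A) :
    IntervalIntegrable (fun x => Real.exp (-(A x) / 2) * k x) volume 0 1 :=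
  Continuous.intervalIntegrable (by fun_prop) _ _

lemma expMoment_one_pos (hA : Continuous A) : 0 < expMoment (fun _ => 1) A :=
  intervalIntegral.intervalIntegral_pos_of_pos_on
    (intervalIntegrable_exp_mul continuous_const hA) (fun x _ => by positivity) one_pos

lemma continuous_meanDensity (hk : Continuous k) (hA : Continuous A) :
    Continuous (meanDensity k A) := by
  unfold meanDensity; fun_prop

lemma integral_meanDensity (hk : Continuous k) (hA : Continuous A) :
    ∫ x in (0 : ℝ)..1, meanDensity k A x = 0 := by
  have h1 := expMoment_one_pos hA
  have h2 : ∫ x in (0 : ℝ)..1, Real.exp (-(A x) / 2) * (k x - expMean k A)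
      = expMoment k A - expMean k A * expMoment (fun _ => 1) A := by
    rw [expMoment, expMoment, ← intervalIntegral.integral_const_mul,
      ← intervalIntegral.integral_sub (intervalIntegrable_exp_mul hk hA)
        ((intervalIntegrable_exp_mul continuous_const hA).const_mul _)]
    congr 1; ext x; ring
  simp only [meanDensity]
  rw [intervalIntegral.integral_div, h2, expMean, div_mul_cancel₀ _ h1.ne', sub_self, zero_div]

/-- Only the values on `[0,1]` count; this permits replacing `primitive f` by a `C¹` function that
coincides with it there. -/
lemma expMoment_congr (h : EqOn A B (Icc 0 1)) : expMoment k A = expMoment k B := by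
  refine intervalIntegral.integral_congr fun x hx => ?_
  rw [uIcc_of_le zero_le_one] at hx
  simp only [h hx]

lemma expMean_congr (h : EqOn A B (Icc 0 1)) : expMean k A = expMean k B := by
  rw [expMean, expMean, expMoment_congr h, expMoment_congr h]

lemma meanDensity_congr (h : EqOn A B (Icc 0 1)) :
    EqOn (meanDensity k A) (meanDensity k B) (Icc 0 1) := fun x hx => by
  rw [meanDensity, meanDensity, expMean_congr h, expMoment_congr h, h hx]

lemma hasDerivAt_expMoment (hk : Continuous k) (hA : Continuous A) (hD : Continuous D) (θ : ℝ) :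
    HasDerivAt (fun θ => expMoment k (fun x => A x + θ * D x))
      (-(1 / 2) * expMoment (fun x => D x * k x) (fun x => A x + θ * D x)) θ := by
  let F' : ℝ → ℝ → ℝ := fun θ x => -(1 / 2) * (Real.exp (-(A x + θ * D x) / 2) * (D x * k x))
  have hF' : Continuous fun p : ℝ × ℝ => F' p.1 p.2 := by
    simp only [F']; fun_prop
  -- Compactness in `(θ, x)` supplies the constant that dominates the derivative under the integral
  -- sign.
  obtain ⟨C, hC⟩ := ((isCompact_closedBall θ 1).prod
    (isCompact_Icc (a := (0 : ℝ)) (b := 1))).exists_bound_of_continuousOn hF'.continuousOn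
  have h := (intervalIntegral.hasDerivAt_integral_of_dominated_loc_of_deriv_le
    (μ := volume) (a := 0) (b := 1) (x₀ := θ)
    (F := fun θ x => Real.exp (-(A x + θ * D x) / 2) * k x) (F' := F') (bound := fun _ => C)
    (Metric.ball_mem_nhds θ one_pos)
    (Eventually.of_forall fun θ => Continuous.aestronglyMeasurable (by fun_prop))
    (intervalIntegrable_exp_mul hk (by fun_prop))
    (Continuous.aestronglyMeasurable (by simp only [F']; fun_prop))
    (ae_of_all _ fun x hx η hη => by
      rw [uIoc_of_le zero_le_one] at hx
      exact hC (η, x) ⟨Metric.ball_subset_closedBall hη, Ioc_subset_Icc_self hx⟩)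
    intervalIntegrable_const
    (ae_of_all _ fun x _ η _ => by
      have h1 : HasDerivAt (fun η : ℝ => -(A x + η * D x) / 2) (-(D x) / 2) η := by
        simpa using (((hasDerivAt_id η).mul_const (D x)).const_add (A x)).neg.div_const 2
      have h2 := (h1.exp).mul_const (k x)
      exact h2.congr_deriv (by simp only [F']; ring))).2
  simp only [F', intervalIntegral.integral_const_mul] at h
  exact h

lemma hasDerivAt_expMean (hk : Continuous k) (hA : Continuous A) (hD : Continuous D) (θ : ℝ) :
    HasDerivAt (fun θ => expMean k (fun x => A x + θ * D x))
      (-(1 / 2) * ∫ x in (0 : ℝ)..1, D x * meanDensity k (fun x => A x + θ * D x) x) θ := by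
  set B : ℝ → ℝ := fun x => A x + θ * D x with hB
  have hBc : Continuous B := by fun_prop
  have hpos := expMoment_one_pos hBc
  have h := (hasDerivAt_expMoment hk hA hD θ).div
    (hasDerivAt_expMoment (k := fun _ => 1) continuous_const hA hD θ) hpos.ne'
  have hint : ∫ x in (0 : ℝ)..1, D x * meanDensity k B x
      = (expMoment (fun x => D x * k x) B
        - expMean k B * expMoment (fun x => D x * 1) B) / expMoment (fun _ => 1) B := by
    have : ∀ x, D x * meanDensity k B x = (Real.exp (-(B x) / 2) * (D x * k x)
        - expMean k B * (Real.exp (-(B x) / 2) * (D x * 1))) / expMoment (fun _ => 1) B := by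
      intro x; rw [meanDensity]; ring
    simp only [this]
    rw [intervalIntegral.integral_div, intervalIntegral.integral_sub
      (intervalIntegrable_exp_mul (by fun_prop) hBc)
      ((intervalIntegrable_exp_mul (by fun_prop) hBc).const_mul _),
      intervalIntegral.integral_const_mul]
    rfl
  refine HasDerivAt.congr_deriv (f := fun θ => expMean k (fun x => A x + θ * D x)) h ?_
  rw [hint, expMean, ← hB]
  field_simp
  ring

/-- Mean value theorem for `A ↦ expMean k A`. -/
lemma exists_expMean_sub_eq (hk : Continuous k) (hA : Continuous A) (hB : Continuous B) :
    ∃ θ ∈ Ioo (0 : ℝ) 1, expMean k B - expMean k A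
      = -(1 / 2) * ∫ x in (0 : ℝ)..1,
          (B x - A x) * meanDensity k (fun x => A x + θ * (B x - A x)) x := by
  have hder := hasDerivAt_expMean hk hA (hB.sub hA)
  obtain ⟨θ, hθ, h⟩ := exists_hasDerivAt_eq_slope _ _ zero_lt_one
    (HasDerivAt.continuousOn fun x _ => hder x) (fun x _ => hder x)
  refine ⟨θ, hθ, ?_⟩
  simp only [Pi.sub_apply] at h
  rw [h]
  simp

/-! ### Bounds -/

lemma exp_mem_of_abs_le {a R : ℝ} (h : |a| ≤ R) :
    (Real.exp (R / 2))⁻¹ ≤ Real.exp (-a / 2) ∧ Real.exp (-a / 2) ≤ Real.exp (R / 2) := by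
  rw [← Real.exp_neg, Real.exp_le_exp, Real.exp_le_exp]
  rw [abs_le] at h
  constructor <;> linarith

lemma abs_exp_sub_exp_le {a b R : ℝ} (ha : |a| ≤ R) (hb : |b| ≤ R) :
    |Real.exp (-a / 2) - Real.exp (-b / 2)| ≤ Real.exp (R / 2) * |a - b| := by
  have h := Convex.norm_image_sub_le_of_norm_hasDerivWithin_le (f := fun a => Real.exp (-a / 2))
    (f' := fun a => Real.exp (-a / 2) * (-1 / 2)) (s := Icc (-R) R) (C := Real.exp (R / 2))
    (fun x _ => (((hasDerivAt_id x).neg.div_const 2).exp).hasDerivWithinAt) (fun x hx => by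
      rw [norm_mul, Real.norm_eq_abs, Real.abs_exp]
      have := (exp_mem_of_abs_le (abs_le.2 hx)).2
      have h2 : ‖(-1 / 2 : ℝ)‖ ≤ 1 := by norm_num [abs_le]
      calc _ ≤ Real.exp (-x / 2) * 1 := by gcongr
        _ ≤ _ := by simpa using this) (convex_Icc _ _) (abs_le.1 hb) (abs_le.1 ha)
  exact h

lemma abs_expMoment_le {R : ℝ} (hk : ∀ x ∈ Icc (0 : ℝ) 1, |k x| ≤ 1)
    (hA : ∀ x ∈ Icc (0 : ℝ) 1, |A x| ≤ R) : |expMoment k A| ≤ Real.exp (R / 2) := by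
  have := intervalIntegral.norm_integral_le_of_norm_le_const (a := 0) (b := 1)
    (f := fun x => Real.exp (-(A x) / 2) * k x) (C := Real.exp (R / 2)) (fun x hx => by
      rw [uIoc_of_le zero_le_one] at hx
      have hx := Ioc_subset_Icc_self hx
      rw [norm_mul, Real.norm_eq_abs, Real.norm_eq_abs, Real.abs_exp]
      calc _ ≤ Real.exp (R / 2) * 1 := by
            gcongr ?_ * ?_
            · exact (exp_mem_of_abs_le (hA x hx)).2
            · exact hk x hx
        _ = _ := mul_one _)
  simpa [expMoment] using this

lemma abs_expMoment_sub_le {R δ : ℝ} (hkc : Continuous k) (hAc : Continuous A) (hBc : Continuous B)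
    (hk : ∀ x ∈ Icc (0 : ℝ) 1, |k x| ≤ 1)
    (hA : ∀ x ∈ Icc (0 : ℝ) 1, |A x| ≤ R) (hB : ∀ x ∈ Icc (0 : ℝ) 1, |B x| ≤ R)
    (hAB : ∀ x ∈ Icc (0 : ℝ) 1, |A x - B x| ≤ δ) :
    |expMoment k A - expMoment k B| ≤ Real.exp (R / 2) * δ := by
  rw [expMoment, expMoment, ← intervalIntegral.integral_sub (intervalIntegrable_exp_mul hkc hAc)
    (intervalIntegrable_exp_mul hkc hBc)]
  have := intervalIntegral.norm_integral_le_of_norm_le_const (a := 0) (b := 1)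
    (f := fun x => Real.exp (-(A x) / 2) * k x - Real.exp (-(B x) / 2) * k x)
    (C := Real.exp (R / 2) * δ) (fun x hx => by
      rw [uIoc_of_le zero_le_one] at hx
      have hx := Ioc_subset_Icc_self hx
      rw [← sub_mul, norm_mul, Real.norm_eq_abs, Real.norm_eq_abs]
      have h0 : 0 ≤ δ := (abs_nonneg _).trans (hAB x hx)
      calc _ ≤ (Real.exp (R / 2) * δ) * 1 := by
            gcongr
            · refine (abs_exp_sub_exp_le (hA x hx) (hB x hx)).trans ?_
              gcongr
              exact hAB x hx
            · exact hk x hx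
        _ = _ := mul_one _)
  simpa using this

lemma le_expMoment_one {R : ℝ} (hAc : Continuous A) (hA : ∀ x ∈ Icc (0 : ℝ) 1, |A x| ≤ R) :
    (Real.exp (R / 2))⁻¹ ≤ expMoment (fun _ => 1) A := by
  have := intervalIntegral.integral_mono_on (μ := volume) zero_le_one
    (intervalIntegrable_const (c := (Real.exp (R / 2))⁻¹))
    (intervalIntegrable_exp_mul (k := fun _ => 1) continuous_const hAc) (fun x hx => by
      rw [mul_one]; exact (exp_mem_of_abs_le (hA x hx)).1)
  simpa [expMoment] using this

/-- `A ↦ meanDensity k A` is Lipschitz on bounded sets, for the uniform norm. -/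
lemma abs_meanDensity_sub_le {R δ : ℝ} (hkc : Continuous k) (hAc : Continuous A)
    (hBc : Continuous B) (hk : ∀ x ∈ Icc (0 : ℝ) 1, |k x| ≤ 1)
    (hA : ∀ x ∈ Icc (0 : ℝ) 1, |A x| ≤ R) (hB : ∀ x ∈ Icc (0 : ℝ) 1, |B x| ≤ R)
    (hAB : ∀ x ∈ Icc (0 : ℝ) 1, |A x - B x| ≤ δ) {x : ℝ} (hx : x ∈ Icc (0 : ℝ) 1) :
    |meanDensity k A x - meanDensity k B x| ≤ 6 * Real.exp (R / 2) ^ 6 * δ := by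
  have hR : 0 ≤ R := (abs_nonneg _).trans (hA x hx)
  have hδ : 0 ≤ δ := (abs_nonneg _).trans (hAB x hx)
  have hone : ∀ x ∈ Icc (0 : ℝ) 1, |(fun _ : ℝ => (1 : ℝ)) x| ≤ 1 := by simp
  have hMA := le_expMoment_one hAc hA
  have hMB := le_expMoment_one hBc hB
  have hM := abs_expMoment_sub_le continuous_const hAc hBc hone hA hB hAB
  have hk1 := abs_expMoment_le hk hA
  have hk1' := abs_expMoment_le hk hB
  have hk2 := abs_expMoment_sub_le hkc hAc hBc hk hA hB hAB
  have hU := (abs_exp_sub_exp_le (hA x hx) (hB x hx)).trans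
    (mul_le_mul_of_nonneg_left (hAB x hx) (Real.exp_pos _).le)
  have hUB := (exp_mem_of_abs_le (hB x hx)).2
  have hkx := hk x hx
  have hUB0 := Real.exp_pos (-(B x) / 2)
  simp only [meanDensity, expMean, div_eq_mul_inv (_ * _), div_eq_mul_inv (expMoment _ _)]
  have hE1 : 1 ≤ Real.exp (R / 2) := Real.one_le_exp (by linarith)
  -- What remains is an inequality between real numbers: with `E = e^{R/2} ≥ 1`, every factor and
  -- every inverse mass is bounded by a power of `E`, and the difference of the products is
  -- telescoped.
  generalize Real.exp (R / 2) = E at *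
  generalize expMoment (fun _ => 1) A = m at *
  generalize expMoment (fun _ => 1) B = m' at *
  generalize expMoment k A = p at *
  generalize expMoment k B = p' at *
  generalize Real.exp (-(A x) / 2) = u at *
  generalize Real.exp (-(B x) / 2) = u' at *
  generalize k x = c at *
  have hE : 0 < E := by linarith
  have hm : 0 < m := lt_of_lt_of_le (by positivity) hMA
  have hm' : 0 < m' := lt_of_lt_of_le (by positivity) hMB
  have hr : |m⁻¹| ≤ E := by
    rw [abs_of_pos (by positivity)]; exact inv_le_of_inv_le₀ hE hMA
  have hr' : |m'⁻¹| ≤ E := by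
    rw [abs_of_pos (by positivity)]; exact inv_le_of_inv_le₀ hE hMB
  have hrr : |m⁻¹ - m'⁻¹| ≤ E ^ 3 * δ := by
    have : m⁻¹ - m'⁻¹ = -(m - m') * m⁻¹ * m'⁻¹ := by field_simp; ring
    rw [this, abs_mul, abs_mul, abs_neg]
    calc _ ≤ (E * δ) * E * E := by gcongr
      _ = _ := by ring
  generalize m⁻¹ = r at *
  generalize m'⁻¹ = r' at *
  have hQQ : |p * r - p' * r'| ≤ 2 * E ^ 4 * δ := by
    have : p * r - p' * r' = p * (r - r') + (p - p') * r' := by ring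
    rw [this]
    calc _ ≤ |p * (r - r')| + |(p - p') * r'| := abs_add_le _ _
      _ ≤ E * (E ^ 3 * δ) + (E * δ) * E := by
          rw [abs_mul, abs_mul]; gcongr
      _ = E ^ 4 * δ + E ^ 2 * δ := by ring
      _ ≤ E ^ 4 * δ + E ^ 4 * δ := by gcongr; norm_num
      _ = _ := by ring
  have hQ : ∀ p r : ℝ, |p| ≤ E → |r| ≤ E → |c - p * r| ≤ 2 * E ^ 2 := by
    intro p r hp hr
    calc _ ≤ |c| + |p * r| := abs_sub _ _
      _ ≤ E ^ 2 + E * E := by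
          rw [abs_mul]; gcongr
          exact hkx.trans (one_le_pow₀ hE1)
      _ = _ := by ring
  have hQA := hQ p r hk1 hr
  have hQB := hQ p' r' hk1' hr'
  have hu' : |u'| ≤ E := by rwa [abs_of_pos hUB0]
  have : u * (c - p * r) * r - u' * (c - p' * r') * r'
      = (u - u') * (c - p * r) * r - u' * (p * r - p' * r') * r
        + u' * (c - p' * r') * (r - r') := by ring
  rw [this]
  calc _ ≤ |(u - u') * (c - p * r) * r| + |u' * (p * r - p' * r') * r|
        + |u' * (c - p' * r') * (r - r')| :=
        (abs_add_le _ _).trans (add_le_add_left (abs_sub _ _) _)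
    _ ≤ (E * δ) * (2 * E ^ 2) * E + E * (2 * E ^ 4 * δ) * E + E * (2 * E ^ 2) * (E ^ 3 * δ) := by
        simp only [abs_mul _ r, abs_mul (u - u'), abs_mul u', abs_mul _ (r - r')]
        gcongr
    _ = 2 * E ^ 4 * δ + 4 * E ^ 6 * δ := by ring
    _ ≤ 2 * E ^ 6 * δ + 4 * E ^ 6 * δ := by gcongr; norm_num
    _ = _ := by ring

end Moments

/-! ### The Cole-Hopf identity on a time slice. -/

/-- **Cole-Hopf**: tested against the gradient of `expMean k`, the Burgers operator becomes the
heat operator. -/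
lemma burgersForm_meanDensity {f g : L2I} (hf : ∀ᵐ x ∂unitVol, f x = primitive g x)
    (hg : primitive g 1 = 0) {k k' k'' : ℝ → ℝ} (hk : ∀ x, HasDerivAt k (k' x) x)
    (hk' : ∀ x, HasDerivAt k' (k'' x) x) (hc : Continuous k'') (h0 : k' 0 = 0) (h1 : k' 1 = 0) :
    burgersForm f g (meanDensity k (primitive f)) = -2 * expMean k'' (primitive f) := by
  have hkc : Continuous k := continuous_iff_continuousAt.2 fun x => (hk x).continuousAt
  have hkc' : Continuous k' := continuous_iff_continuousAt.2 fun x => (hk' x).continuousAt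
  set F := primitive g with hF
  have hFc : Continuous F := continuous_primitive g
  -- `P` is differentiable everywhere, with derivative the continuous representative `F` of `f`.
  set P := integralFromZero F with hP
  have hPd : ∀ x, HasDerivAt P (F x) x := hasDerivAt_integralFromZero hFc
  have hPc : Continuous P := continuous_integralFromZero hFc
  have hPf : EqOn (primitive f) P (Icc 0 1) := fun x hx => primitive_congr hf hx
  rw [expMean_congr hPf]
  set m := expMoment (fun _ => 1) P with hm
  have hmpos : 0 < m := expMoment_one_pos hPc
  set q := expMean k P with hq
  set h := meanDensity k P with hh
  have hhc : Continuous h := continuous_meanDensity hkc hPc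
  set V := integralFromZero h with hV
  have hVd : ∀ x, HasDerivAt V (h x) x := hasDerivAt_integralFromZero hhc
  have hVc : Continuous V := continuous_integralFromZero hhc
  have hV1 : V 1 = 0 := integral_meanDensity hkc hPc
  set U : ℝ → ℝ := fun x => Real.exp (-(P x) / 2) with hU
  have hUc : Continuous U := by fun_prop
  have hUd : ∀ x, HasDerivAt U (U x * (-(F x) / 2)) x := fun x => ((hPd x).neg.div_const 2).exp
  have hhd : ∀ x, HasDerivAt h
      ((U x * (-(F x) / 2) * (k x - q) + U x * k' x) / m) x := fun x =>
    ((hUd x).mul ((hk x).sub_const q)).div_const m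
  have hUk : ∀ x, HasDerivAt (fun x => 2 / m * (U x * k' x))
      (2 / m * (U x * (-(F x) / 2) * k' x + U x * k'' x)) x := fun x =>
    ((hUd x).mul (hk' x)).const_mul _
  have hFac := absolutelyContinuous_primitive g
  -- This is an explicit antiderivative. Since `h' = -F h / 2 + U k' / m`, the terms in `F² h` and
  -- in `F U k'` cancel in its derivative, and it vanishes at both ends because `F` and `k'` do.
  have hW := integral_eq_sub_of_absolutelyContinuous
    (F := fun x => 1 / 2 * (F x * F x * V x) + F x * h x + 2 / m * (U x * k' x))
    (G := fun x => F x * g x * V x + g x * h x + 2 / m * (U x * k'' x))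
    (((((hFac.fun_mul hFac).fun_mul (absolutelyContinuous_of_hasDerivAt hVd hhc)).const_mul
      (1 / 2)).fun_add (hFac.fun_mul (absolutelyContinuous_of_hasDerivAt hhd (by fun_prop)))).fun_add
      (absolutelyContinuous_of_hasDerivAt hUk (by fun_prop)))
    ((ae_hasDerivAt_primitive g).mono fun x hx => by
      have := ((((hx.mul hx).mul (hVd x)).const_mul (1 / 2)).add (hx.mul (hhd x))).add (hUk x)
      refine this.congr_deriv ?_
      have e : h x = U x * (k x - q) / m := rfl
      simp only [← hF, Pi.mul_apply]
      rw [e]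
      field_simp
      ring)
  have hg0 : F 0 = 0 := primitive_zero g
  rw [hg0, hg, h0, h1] at hW
  have e1 : ∫ x in Ioo (0 : ℝ) 1, f x * g x * integralFromZero (meanDensity k (primitive f)) x
      = ∫ x in Ioo (0 : ℝ) 1, F x * g x * V x := by
    refine integral_congr_ae ?_
    filter_upwards [hf, ae_unitVol_iff.2 (ae_of_all _ fun x hx => hx)] with x hx hxI
    rw [hx]
    congr 1
    refine intervalIntegral.integral_congr fun y hy => ?_
    rw [uIcc_of_le hxI.1.le] at hy
    exact meanDensity_congr hPf ⟨hy.1, hy.2.trans hxI.2.le⟩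
  have e2 : ∫ x in Ioo (0 : ℝ) 1, g x * meanDensity k (primitive f) x
      = ∫ x in Ioo (0 : ℝ) 1, g x * h x :=
    setIntegral_congr_fun measurableSet_Ioo fun x hx => by
      rw [meanDensity_congr hPf (Ioo_subset_Icc_self hx)]
  have i1 : Integrable (fun x => F x * g x * V x) unitVol :=
    (integrable_mul g (hFc.mul hVc)).congr (ae_of_all _ fun x => by
      simp only [Pi.mul_apply]; ring)
  have i2 : Integrable (fun x => g x * h x) unitVol := integrable_mul g hhc
  have i3 : Integrable (fun x => 2 / m * (U x * k'' x)) unitVol :=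
    (Continuous.integrableOn_Icc (by fun_prop)).mono_set Ioo_subset_Icc_self
  rw [integral_add (f := fun x => F x * g x * V x + g x * h x) (i1.add i2) i3,
    integral_add i1 i2, integral_const_mul,
    setIntegral_Ioo_eq (fun x => U x * k'' x)] at hW
  have e3 : ∫ x in (0 : ℝ)..1, U x * k'' x = expMoment k'' P := rfl
  rw [e3] at hW
  rw [burgersForm, e1, e2, expMean, ← hm]
  have : 2 / m * expMoment k'' P = 2 * (expMoment k'' P / m) := by ring
  rw [this] at hW
  simp only [zero_mul, mul_zero, add_zero, sub_zero] at hW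
  linarith

/-! ### Evolution of the moments in time. -/

/-- A function whose increments are negligible with respect to an integrable density is
constant. -/
lemma eq_of_abs_sub_le_mul_integral {Z ρ : ℝ → ℝ} {T : ℝ} (hρ : IntegrableOn ρ (Ioo 0 T))
    (H : ∀ η > 0, ∃ δ > 0, ∀ s ∈ Icc 0 T, ∀ t ∈ Icc 0 T, s ≤ t → t - s < δ →
      |Z t - Z s| ≤ η * ∫ τ in s..t, ρ τ) {t : ℝ} (ht : t ∈ Icc 0 T) : Z t = Z 0 := by
  have key : ∀ η > 0, |Z t - Z 0| ≤ η * ∫ τ in (0 : ℝ)..t, ρ τ := by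
    intro η hη
    obtain ⟨δ, hδ, h⟩ := H η hη
    -- Cutting `[0,t]` into `n` equal steps shorter than `δ`, the bounds on the increments add up to
    -- `η ∫₀ᵗ ρ`.
    obtain ⟨n, hn⟩ := exists_nat_gt (t / δ)
    have hn0 : (0 : ℝ) < n := lt_of_le_of_lt (div_nonneg ht.1 hδ.le) hn
    set a : ℕ → ℝ := fun i => i * (t / n) with ha
    have hstep : ∀ i, a (i + 1) - a i = t / n := fun i => by simp [ha]; ring
    have han : a n = t := by simp only [ha]; field_simp
    have ha0 : a 0 = 0 := by simp [ha]
    have htn : 0 ≤ t / n := div_nonneg ht.1 hn0.le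
    have hmem : ∀ i ≤ n, a i ∈ Icc 0 T := fun i hi => by
      refine ⟨by simp only [ha]; positivity, le_trans ?_ ht.2⟩
      rw [← han]
      simp only [ha]
      gcongr
    have hint : ∀ i < n, IntervalIntegrable ρ volume (a i) (a (i + 1)) := fun i hi =>
      PotentialSolution.intervalIntegrable_of_integrableOn hρ (hmem i hi.le) (hmem (i + 1) hi)
    calc |Z t - Z 0| = |∑ i ∈ Finset.range n, (Z (a (i + 1)) - Z (a i))| := by
          rw [Finset.sum_range_sub (fun i => Z (a i)), han, ha0]
      _ ≤ ∑ i ∈ Finset.range n, |Z (a (i + 1)) - Z (a i)| := Finset.abs_sum_le_sum_abs _ _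
      _ ≤ ∑ i ∈ Finset.range n, η * ∫ τ in a i..a (i + 1), ρ τ := by
          refine Finset.sum_le_sum fun i hi => ?_
          have hi := Finset.mem_range.1 hi
          refine h _ (hmem i hi.le) _ (hmem (i + 1) hi) ?_ ?_
          · linarith [hstep i]
          · rw [hstep i, div_lt_iff₀ hn0]
            rwa [div_lt_iff₀ hδ, mul_comm] at hn
      _ = η * ∫ τ in (0 : ℝ)..t, ρ τ := by
          rw [← Finset.mul_sum, intervalIntegral.sum_integral_adjacent_intervals hint, han, ha0]
  have hlim : Tendsto (fun η : ℝ => η * ∫ τ in (0 : ℝ)..t, ρ τ) (𝓝[>] 0) (𝓝 0) := by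
    have : Continuous fun η : ℝ => η * ∫ τ in (0 : ℝ)..t, ρ τ := by fun_prop
    simpa using (this.tendsto 0).mono_left nhdsWithin_le_nhds
  have h0 : |Z t - Z 0| ≤ 0 :=
    ge_of_tendsto hlim (eventually_nhdsWithin_of_forall fun η hη => key η hη)
  exact sub_eq_zero.1 (abs_nonpos_iff.1 h0)

/-- A continuous solution of the integrated equation `q' = -λ q` is an exponential. -/
lemma eq_exp_mul_of_integral_eq {q : ℝ → ℝ} {T l : ℝ} (hT : 0 < T) (hq : ContinuousOn q (Icc 0 T))
    (h : ∀ t ∈ Icc 0 T, q t + l * ∫ s in (0 : ℝ)..t, q s = q 0) :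
    q T = Real.exp (-l * T) * q 0 := by
  -- A continuous extension of `q` to `ℝ` has a primitive differentiable everywhere, including at
  -- the ends of `[0,T]`.
  obtain ⟨Q, hQc, hQ⟩ : ∃ Q : ℝ → ℝ, Continuous Q ∧ EqOn Q q (Icc 0 T) :=
    ⟨IccExtend hT.le ((Icc 0 T).domRestrict q), hq.domRestrict.Icc_extend',
      fun x hx => IccExtend_of_mem _ _ hx⟩
  have hY : ∀ t ∈ Icc 0 T, ∫ s in (0 : ℝ)..t, q s = integralFromZero Q t := fun t ht =>
    intervalIntegral.integral_congr fun s hs => by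
      rw [uIcc_of_le ht.1] at hs
      exact (hQ ⟨hs.1, hs.2.trans ht.2⟩).symm
  -- The integrating factor: on `[0,T]` this function is `e^{lt} q(t)`, and its derivative vanishes
  -- there.
  have hd : ∀ t, HasDerivAt (fun t => Real.exp (l * t) * (q 0 - l * integralFromZero Q t))
      (Real.exp (l * t) * (l * 1) * (q 0 - l * integralFromZero Q t)
        + Real.exp (l * t) * (0 - l * Q t)) t := fun t =>
    (((hasDerivAt_id t).const_mul l).exp).mul
      ((hasDerivAt_const t (q 0)).sub ((hasDerivAt_integralFromZero hQc t).const_mul l))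
  obtain ⟨c, hc, hc'⟩ := exists_hasDerivAt_eq_slope _ _ hT
    (HasDerivAt.continuousOn fun x _ => hd x) fun x _ => hd x
  have hcI := Ioo_subset_Icc_self hc
  have hz : Real.exp (l * c) * (l * 1) * (q 0 - l * integralFromZero Q c)
      + Real.exp (l * c) * (0 - l * Q c) = 0 := by
    rw [hQ hcI, ← h c hcI, hY c hcI]; ring
  rw [hz, eq_comm, div_eq_zero_iff, or_iff_left (by linarith [hT.ne']), ← hY T ⟨hT.le, le_rfl⟩]
    at hc'
  have hT' := h T ⟨hT.le, le_rfl⟩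
  have e : q 0 - l * ∫ s in (0 : ℝ)..T, q s = q T := by linarith
  rw [e] at hc'
  simp only [integralFromZero, mul_zero, Real.exp_zero, intervalIntegral.integral_same, sub_zero,
    one_mul] at hc'
  rw [← sub_eq_zero.1 hc', ← mul_assoc, ← Real.exp_add]
  simp

/-- Evaluation of the primitive is `1`-Lipschitz in `f`, uniformly in the point. -/
lemma continuous_uncurry_primitive : Continuous fun p : L2I × ℝ => primitive p.1 p.2 :=
  continuous_prod_of_continuous_lipschitzWith _ 1 (fun f => continuous_primitive f) fun x =>
    LipschitzWith.of_dist_le_mul fun f g => by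
      simpa [Real.dist_eq, dist_eq_norm] using abs_primitive_sub_le f g x

lemma continuous_expMoment_primitive {k : ℝ → ℝ} (hk : Continuous k) :
    Continuous fun f : L2I => expMoment k (primitive f) := by
  refine intervalIntegral.continuous_parametric_intervalIntegral_of_continuous'
    (f := fun (f : L2I) x => Real.exp (-(primitive f x) / 2) * k x) ?_ 0 1
  have := continuous_uncurry_primitive
  have h2 : Continuous fun p : L2I × ℝ => Real.exp (-(primitive p.1 p.2) / 2) * k p.2 := by
    fun_prop
  exact h2

lemma continuous_expMean_primitive {k : ℝ → ℝ} (hk : Continuous k) :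
    Continuous fun f : L2I => expMean k (primitive f) :=
  (continuous_expMoment_primitive hk).div (continuous_expMoment_primitive continuous_const)
    fun f => (expMoment_one_pos (continuous_primitive f)).ne'

/-- Along a solution of the Burgers equation, the normalised Neumann moments of the Cole-Hopf
transform decay exponentially. -/
lemma PotentialSolution.expMean_eq {T : ℝ} (hT : 0 < T) {φ φx : ℝ → L2I}
    (hφ : PotentialSolution T φ φx) {k k' : ℝ → ℝ} {l : ℝ}
    (hk : ∀ x, HasDerivAt k (k' x) x) (hk' : ∀ x, HasDerivAt k' (-l * k x) x)
    (h0 : k' 0 = 0) (h1 : k' 1 = 0) (hb : ∀ x ∈ Icc (0 : ℝ) 1, |k x| ≤ 1) :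
    expMean k (primitive (φ T)) = Real.exp (-l * T) * expMean k (primitive (φ 0)) := by
  have hkc : Continuous k := continuous_iff_continuousAt.2 fun x => (hk x).continuousAt
  set q : ℝ → ℝ := fun t => expMean k (primitive (φ t)) with hq
  have hqc : ContinuousOn q (Icc 0 T) :=
    (continuous_expMean_primitive hkc).comp_continuousOn hφ.continuousOn
  have hqi : IntegrableOn q (Ioo 0 T) := hqc.integrableOn_Icc.mono_set Ioo_subset_Icc_self
  obtain ⟨R, hR0, hR⟩ := hφ.exists_bound
  have hPR : ∀ t ∈ Icc 0 T, ∀ x ∈ Icc (0 : ℝ) 1, |primitive (φ t) x| ≤ R := fun t ht x _ =>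
    (abs_primitive_le _ _).trans (hR t ht)
  have hB : ∀ᵐ t, t ∈ Ioo 0 T →
      burgersForm (φ t) (φx t) (meanDensity k (primitive (φ t))) = 2 * l * q t := by
    filter_upwards [(ae_restrict_iff' measurableSet_Ioo).1 hφ.ae_slice] with t ht htI
    rw [burgersForm_meanDensity (ht htI).1 (ht htI).2 hk hk' (by fun_prop) h0 h1]
    have : expMoment (fun x => -l * k x) (primitive (φ t)) = -l * expMoment k (primitive (φ t)) := by
      rw [expMoment, expMoment, ← intervalIntegral.integral_const_mul]
      congr 1; ext x; ring
    simp only [hq]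
    rw [expMean, this, expMean]
    ring
  refine eq_exp_mul_of_integral_eq hT hqc fun t ht => ?_
  -- On a short interval `[s,t]` the mean value theorem writes `q t - q s` with one frozen density,
  -- against which the equation can be tested. Replacing it by the density of time `τ`, where the
  -- Cole-Hopf identity is exact, costs a small multiple of `∫ ‖φx‖`. Thus `q` need not be
  -- differentiated in time.
  have := eq_of_abs_sub_le_mul_integral (Z := fun t => q t + l * ∫ s in (0 : ℝ)..t, q s)
    (ρ := fun s => ‖φx s‖) hφ.integrable_norm (fun η hη => ?_) ht
  · simpa using this
  set C : ℝ := 6 * Real.exp (R / 2) ^ 6 with hC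
  have hCpos : 0 < C := by positivity
  -- Chosen so that the final error `(1/2) · C · 2w · (R + 1)` equals `η`.
  set w : ℝ := η / (C * (R + 1)) with hw
  have hwpos : 0 < w := by positivity
  have huc := (isCompact_Icc (a := (0 : ℝ)) (b := T)).uniformContinuousOn_of_continuous
    hφ.continuousOn
  obtain ⟨δ, hδ, huc⟩ := Metric.uniformContinuousOn_iff.1 huc w hwpos
  refine ⟨δ, hδ, fun s hs t ht hst htδ => ?_⟩
  have hclose : ∀ τ ∈ Icc s t, ∀ x, |primitive (φ τ) x - primitive (φ s) x| ≤ w := by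
    intro τ hτ x
    refine (abs_primitive_sub_le _ _ _).trans ?_
    rw [← dist_eq_norm]
    refine (huc _ ⟨hs.1.trans hτ.1, hτ.2.trans ht.2⟩ _ hs ?_).le
    rw [Real.dist_eq, abs_of_nonneg (by linarith [hτ.1])]
    linarith [hτ.2]
  obtain ⟨θ, hθ, hmv⟩ := exists_expMean_sub_eq hkc (continuous_primitive (φ s))
    (continuous_primitive (φ t))
  set A : ℝ → ℝ := fun x => primitive (φ s) x + θ * (primitive (φ t) x - primitive (φ s) x)
    with hA
  have hAc : Continuous A := by fun_prop
  have hAR : ∀ x ∈ Icc (0 : ℝ) 1, |A x| ≤ R := fun x hx => by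
    have e : A x = (1 - θ) * primitive (φ s) x + θ * primitive (φ t) x := by simp only [hA]; ring
    rw [e]
    calc _ ≤ |(1 - θ) * primitive (φ s) x| + |θ * primitive (φ t) x| := abs_add_le _ _
      _ = (1 - θ) * |primitive (φ s) x| + θ * |primitive (φ t) x| := by
          rw [abs_mul, abs_mul, abs_of_pos hθ.1, abs_of_pos (by linarith [hθ.2] : 0 < 1 - θ)]
      _ ≤ (1 - θ) * R + θ * R := by
          have := hθ.1.le
          have : 0 ≤ 1 - θ := by linarith [hθ.2]
          gcongr
          · exact hPR s hs x hx
          · exact hPR t ht x hx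
      _ = R := by ring
  have hAτ : ∀ τ ∈ Icc s t, ∀ x ∈ Icc (0 : ℝ) 1, |A x - primitive (φ τ) x| ≤ 2 * w := by
    intro τ hτ x _
    have e : A x - primitive (φ τ) x = θ * (primitive (φ t) x - primitive (φ s) x)
        - (primitive (φ τ) x - primitive (φ s) x) := by simp only [hA]; ring
    rw [e]
    calc _ ≤ |θ * (primitive (φ t) x - primitive (φ s) x)|
          + |primitive (φ τ) x - primitive (φ s) x| := abs_sub _ _
      _ ≤ 1 * w + w := by
          rw [abs_mul, abs_of_pos hθ.1]
          gcongr
          · exact hθ.2.le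
          · exact hclose t ⟨hst, le_rfl⟩ x
          · exact hclose τ hτ x
      _ = 2 * w := by ring
  have hhc := continuous_meanDensity hkc hAc
  have hform := hφ.integrableOn_burgersForm hhc
  have hformI := PotentialSolution.intervalIntegrable_of_integrableOn hform hs ht
  have hqI := fun {a b : ℝ} (ha : a ∈ Icc 0 T) (hb : b ∈ Icc 0 T) =>
    PotentialSolution.intervalIntegrable_of_integrableOn hqi ha hb
  have h0T : (0 : ℝ) ∈ Icc 0 T := ⟨le_rfl, hT.le⟩
  rw [hφ.equation_sub hhc (integral_meanDensity hkc hAc) hs ht] at hmv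
  have hZ : (q t + l * ∫ s in (0 : ℝ)..t, q s) - (q s + l * ∫ r in (0 : ℝ)..s, q r)
      = -(1 / 2) * ∫ τ in s..t, (burgersForm (φ τ) (φx τ) (meanDensity k A) - 2 * l * q τ) := by
    rw [intervalIntegral.integral_sub hformI ((hqI hs ht).const_mul _),
      intervalIntegral.integral_const_mul,
      ← intervalIntegral.integral_interval_sub_left (hqI h0T ht) (hqI h0T hs)]
    simp only [hq] at hmv ⊢
    linarith
  have hρ := PotentialSolution.intervalIntegrable_of_integrableOn hφ.integrable_norm hs ht
  have hint : |∫ τ in s..t, (burgersForm (φ τ) (φx τ) (meanDensity k A) - 2 * l * q τ)|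
      ≤ ∫ τ in s..t, C * (2 * w) * (R + 1) * ‖φx τ‖ := by
    rw [← Real.norm_eq_abs]
    refine intervalIntegral.norm_integral_le_of_norm_le hst ?_ (hρ.const_mul _)
    filter_upwards [hB, (by simp [ae_iff] : ∀ᵐ y : ℝ, y ≠ T)] with τ hτ hτT hτI
    have hτ0 : τ ∈ Ioo 0 T :=
      ⟨hs.1.trans_lt hτI.1, lt_of_le_of_ne (hτI.2.trans ht.2) hτT⟩
    have hτR := hR τ (Ioo_subset_Icc_self hτ0)
    rw [← hτ hτ0, ← burgersForm_sub _ _ hhc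
      (continuous_meanDensity hkc (continuous_primitive _)), Real.norm_eq_abs]
    refine (abs_burgersForm_le (C := C * (2 * w)) _ _ fun x hx =>
      abs_meanDensity_sub_le hkc hAc (continuous_primitive _) hb hAR
        (hPR τ (Ioo_subset_Icc_self hτ0)) (hAτ τ (Ioc_subset_Icc_self hτI)) hx).trans ?_
    have : ‖φ τ‖ * ‖φx τ‖ ≤ R * ‖φx τ‖ := by gcongr
    calc C * (2 * w) * (‖φ τ‖ * ‖φx τ‖ + ‖φx τ‖) ≤ C * (2 * w) * (R * ‖φx τ‖ + ‖φx τ‖) := by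
          gcongr
      _ = _ := by ring
  rw [hZ, abs_mul]
  rw [intervalIntegral.integral_const_mul] at hint
  calc _ ≤ |-(1 / 2 : ℝ)| * (C * (2 * w) * (R + 1) * ∫ τ in s..t, ‖φx τ‖) := by gcongr
    _ = η * ∫ τ in s..t, ‖φx τ‖ := by
      rw [hw, abs_neg, abs_of_pos (by norm_num)]
      field_simp

/-! ### Recovering the solution at time `T` from its cosine series. -/

/-- The majorant of the Fourier coefficients of the Neumann heat semigroup at time `T` and of their
first derivatives. -/
def heatMajorant (T : ℝ) (n : ℤ) : ℝ :=
  (1 + Real.pi * |(n : ℝ)|) * Real.exp (-(n * Real.pi) ^ 2 * T)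

lemma summable_heatMajorant {T : ℝ} (hT : 0 < T) : Summable (heatMajorant T) := by
  have h : Summable fun n : ℕ => heatMajorant T n := by
    have hr : 0 < Real.pi ^ 2 * T := by positivity
    have h0 := Real.summable_pow_mul_exp_neg_nat_mul 0 hr
    have h1 := (Real.summable_pow_mul_exp_neg_nat_mul 1 hr).mul_left Real.pi
    refine (h0.add h1).of_nonneg_of_le (fun n => by unfold heatMajorant; positivity) fun n => ?_
    -- Since `n ≤ n²`, the Gaussian factor is dominated by a geometric one.
    have hn : (n : ℝ) ≤ (n : ℝ) ^ 2 := by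
      exact_mod_cast Nat.le_self_pow two_ne_zero n
    have he : Real.exp (-(n * Real.pi) ^ 2 * T) ≤ Real.exp (-(Real.pi ^ 2 * T) * n) := by
      rw [Real.exp_le_exp]
      nlinarith [mul_le_mul_of_nonneg_left hn hr.le]
    calc heatMajorant T n = (1 + Real.pi * n) * Real.exp (-(n * Real.pi) ^ 2 * T) := by
          simp [heatMajorant]
      _ ≤ (1 + Real.pi * n) * Real.exp (-(Real.pi ^ 2 * T) * n) := by gcongr
      _ = _ := by ring
  refine Summable.of_nat_of_neg h (h.congr fun n => ?_)
  simp [heatMajorant]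

lemma heatMajorant_nonneg (T : ℝ) (n : ℤ) : 0 ≤ heatMajorant T n := by
  unfold heatMajorant; positivity

/-- The sum of the majorants `heatMajorant T`. -/
def heatConstant (T : ℝ) : ℝ := ∑' n, heatMajorant T n

lemma heatConstant_pos {T : ℝ} (hT : 0 < T) : 0 < heatConstant T :=
  (summable_heatMajorant hT).tsum_pos (heatMajorant_nonneg T) 0 (by simp [heatMajorant])

instance fact_zero_lt_two : Fact ((0 : ℝ) < 2) := ⟨two_pos⟩

/-- The even extension of `Y` from `[0,1]` to the circle of length `2`. -/
def evenCircle (Y : ℝ → ℝ) : AddCircle (2 : ℝ) → ℂ :=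
  AddCircle.liftIco 2 (-1) fun x => (Y |x| : ℂ)

lemma continuous_evenCircle {Y : ℝ → ℝ} (hY : Continuous Y) : Continuous (evenCircle Y) :=
  AddCircle.liftIco_continuous (by norm_num) (Continuous.continuousOn (by fun_prop))

lemma evenCircle_coe {Y : ℝ → ℝ} {x : ℝ} (hx : x ∈ Ioo (0 : ℝ) 1) :
    evenCircle Y (x : AddCircle (2 : ℝ)) = Y x := by
  rw [evenCircle, AddCircle.liftIco_coe_apply (by constructor <;> linarith [hx.1, hx.2]),
    abs_of_pos hx.1]

lemma norm_fourier_apply (n : ℤ) (x : AddCircle (2 : ℝ)) : ‖fourier n x‖ = 1 := by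
  rw [fourier_apply]; exact Circle.norm_coe _

/-- Folding `[-1,0]` onto `[0,1]` pairs conjugate exponentials into `2 cos`, and this `2` cancels
the factor `1/2` of the period. -/
lemma fourierCoeff_evenCircle {Y : ℝ → ℝ} (hY : Continuous Y) (n : ℤ) :
    fourierCoeff (evenCircle Y) n
      = ((∫ x in (0 : ℝ)..1, Y x * Real.cos (n * Real.pi * x) : ℝ) : ℂ) := by
  rw [evenCircle, fourierCoeff_liftIco_eq, fourierCoeffOn_eq_integral]
  set g : ℝ → ℂ := fun x => Complex.exp (-(n * Real.pi * x * Complex.I)) * (Y |x| : ℂ) with hg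
  have hgc : Continuous g := by fun_prop
  have e1 : ∀ x : ℝ, (fourier (-n) (x : AddCircle ((-1 + 2 : ℝ) - -1))) • (Y |x| : ℂ) = g x := by
    intro x
    rw [fourier_coe_apply, smul_eq_mul]
    simp only [hg]
    congr 2
    push_cast
    ring
  simp only [e1]
  have e2 : ∫ x in (-1 : ℝ)..(-1 + 2), g x
      = ∫ x in (0 : ℝ)..1, (2 * (Y x * Real.cos (n * Real.pi * x) : ℝ) : ℂ) := by
    rw [show (-1 + 2 : ℝ) = 1 by norm_num, ← intervalIntegral.integral_add_adjacent_intervals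
      (hgc.intervalIntegrable (-1) 0) (hgc.intervalIntegrable 0 1)]
    have := intervalIntegral.integral_comp_neg (a := 0) (b := 1) g
    rw [neg_zero] at this
    have hgn : Continuous fun x => g (-x) := hgc.comp continuous_neg
    rw [← this, ← intervalIntegral.integral_add (hgn.intervalIntegrable _ _) (hgc.intervalIntegrable _ _)]
    refine intervalIntegral.integral_congr fun x hx => ?_
    rw [uIcc_of_le zero_le_one] at hx
    simp only [hg, abs_neg, abs_of_nonneg hx.1]
    push_cast
    rw [Complex.cos]
    have e3 : -(n * Real.pi * (-x) * Complex.I) = (n * Real.pi * x : ℂ) * Complex.I := by ring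
    have e4 : -(n * Real.pi * x * Complex.I) = -(n * Real.pi * x : ℂ) * Complex.I := by ring
    rw [e3, e4]
    ring
  rw [e2, intervalIntegral.integral_const_mul, intervalIntegral.integral_ofReal]
  rw [Complex.real_smul, ← mul_assoc]
  norm_num

/-- If the cosine coefficients of `e^{-P/2} / ∫ e^{-P/2}` (with `P` the primitive of `f`) decay
like those of a solution of the heat equation, then `f` is small. -/
lemma norm_le_of_expMean_le {f : L2I} {T η : ℝ} (hT : 0 < T) (hη : 0 ≤ η)
    (hS : heatConstant T * η ≤ 1 / 2)
    (h : ∀ n : ℤ, n ≠ 0 → |expMean (fun x => Real.cos (n * Real.pi * x)) (primitive f)|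
      ≤ Real.exp (-(n * Real.pi) ^ 2 * T) * η) :
    ‖f‖ ≤ 4 * (heatConstant T * η) := by
  set P := primitive f with hP
  have hPc : Continuous P := continuous_primitive f
  have hm := expMoment_one_pos hPc
  set m := expMoment (fun _ => 1) P with hmdef
  -- The normalisation gives `Y` mean `1`, so its coefficient of index `0` is exactly `1`.
  set Y : ℝ → ℝ := fun x => Real.exp (-(P x) / 2) / m with hY
  have hYc : Continuous Y := by fun_prop
  have hYpos : ∀ x, 0 < Y x := fun x => by positivity
  set c : ℤ → ℂ := fourierCoeff (evenCircle Y) with hc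
  have hcn : ∀ n, c n = (expMean (fun x => Real.cos (n * Real.pi * x)) P : ℂ) := fun n => by
    rw [hc, fourierCoeff_evenCircle hYc, expMean, expMoment, ← hmdef,
      ← intervalIntegral.integral_div]
    congr 2
    ext x
    simp only [hY]; ring
  have hc0 : c 0 = 1 := by
    rw [hcn]
    simp only [Int.cast_zero, zero_mul, Real.cos_zero]
    rw [expMean, div_self hm.ne', Complex.ofReal_one]
  have hcb : ∀ n ≠ 0, ‖c n‖ ≤ Real.exp (-(n * Real.pi) ^ 2 * T) * η := fun n hn => by
    rw [hcn, Complex.norm_real]; exact h n hn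
  have hpi := Real.pi_pos
  have hmaj : ∀ n : ℤ, Real.exp (-(n * Real.pi) ^ 2 * T) * η ≤ heatMajorant T n * η := fun n => by
    refine mul_le_mul_of_nonneg_right ?_ hη
    rw [heatMajorant]
    exact le_mul_of_one_le_left (Real.exp_pos _).le (by simp; positivity)
  have hsum := summable_heatMajorant hT
  have hsη : HasSum (fun n => heatMajorant T n * η) (heatConstant T * η) := hsum.hasSum.mul_right η
  have hdiff : ∀ n, ‖c n - if n = 0 then 1 else 0‖ ≤ heatMajorant T n * η := by
    intro n
    by_cases hn : n = 0
    · subst hn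
      simp only [hc0, if_true, sub_self, norm_zero]
      exact mul_nonneg (heatMajorant_nonneg _ _) hη
    · rw [if_neg hn, sub_zero]
      exact (hcb n hn).trans (hmaj n)
  have hone : HasSum (fun n : ℤ => if n = 0 then (1 : ℂ) else 0) 1 := hasSum_ite_eq 0 1
  have hcs : Summable c := by
    have h1 : Summable fun n => c n - if n = 0 then (1 : ℂ) else 0 :=
      Summable.of_norm_bounded hsη.summable hdiff
    exact (h1.add hone.summable).congr fun n => by ring
  have hser : ∀ x : AddCircle (2 : ℝ), HasSum (fun n => c n • fourier n x) (evenCircle Y x) :=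
    fun x => has_pointwise_sum_fourier_series_of_summable
      (f := ⟨evenCircle Y, continuous_evenCircle hYc⟩) hcs x
  have hclose : ∀ x ∈ Ioo (0 : ℝ) 1, |Y x - 1| ≤ heatConstant T * η := by
    intro x hx
    have h1 := (hser x).sub hone
    rw [evenCircle_coe hx] at h1
    have h2 : ∀ n : ℤ, ‖c n • fourier n (x : AddCircle (2 : ℝ)) - (if n = 0 then (1 : ℂ) else 0)‖
        ≤ heatMajorant T n * η := by
      intro n
      refine le_trans (le_of_eq ?_) (hdiff n)
      by_cases hn : n = 0
      · subst hn; simp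
      · simp only [if_neg hn, sub_zero]
        rw [norm_smul, norm_fourier_apply, mul_one]
    have h3 := tsum_of_norm_bounded hsη h2
    rw [h1.tsum_eq, ← Complex.ofReal_one, ← Complex.ofReal_sub, Complex.norm_real] at h3
    exact h3
  have hbd : ∀ (n : ℤ) (y : ℝ), ‖c n * (2 * Real.pi * Complex.I * n / (2 : ℝ)
      * fourier n (y : AddCircle (2 : ℝ)))‖ ≤ heatMajorant T n * η := by
    intro n y
    rw [norm_mul, norm_mul, norm_fourier_apply, mul_one]
    have e : ‖(2 * Real.pi * Complex.I * n / (2 : ℝ) : ℂ)‖ = Real.pi * |(n : ℝ)| := by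
      simp [abs_of_pos hpi]; ring
    rw [e]
    by_cases hn : n = 0
    · subst hn
      simpa using mul_nonneg (heatMajorant_nonneg T 0) hη
    · calc _ ≤ Real.exp (-(n * Real.pi) ^ 2 * T) * η * (Real.pi * |(n : ℝ)|) := by
            gcongr; exact hcb n hn
        _ = (Real.pi * |(n : ℝ)|) * Real.exp (-(n * Real.pi) ^ 2 * T) * η := by ring
        _ ≤ heatMajorant T n * η := by
            rw [heatMajorant]
            gcongr
            linarith
  -- Termwise differentiation is justified because the majorant also covers the factor `π|n|`.
  have hder : ∀ y : ℝ, HasDerivAt (fun y : ℝ => ∑' n, c n * fourier n (y : AddCircle (2 : ℝ)))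
      (∑' n, c n * (2 * Real.pi * Complex.I * n / (2 : ℝ)
        * fourier n (y : AddCircle (2 : ℝ)))) y := fun y =>
    hasDerivAt_tsum hsη.summable (fun n y => (hasDerivAt_fourier 2 n y).const_mul (c n)) hbd
      (hser ((0 : ℝ) : AddCircle (2 : ℝ))).summable y
  -- The constant `4` comes from `Y |f| / 2 ≤ heatConstant T * η` and `Y ≥ 1/2`; a uniform bound
  -- controls the `L²` norm since the interval has measure `1`.
  refine Lp.norm_le_of_ae_bound (C := 4 * (heatConstant T * η))
    (mul_nonneg (by norm_num) (mul_nonneg (heatConstant_pos hT).le hη)) ?_ |>.trans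
      (by simp [show measureUnivNNReal unitVol = 1 by simp [measureUnivNNReal]])
  filter_upwards [ae_hasDerivAt_primitive f, ae_unitVol_iff.2 (ae_of_all _ fun x hx => hx)]
    with x hx hxI
  have h1 : HasDerivAt (fun y => (Y y : ℂ)) ((Y x * (-(f x) / 2) : ℝ) : ℂ) x := by
    have := ((hx.neg.div_const 2).exp).div_const m
    refine HasDerivAt.ofReal_comp (this.congr_deriv ?_)
    simp only [hY, hP]; simp; ring
  have h2 : (fun y => (Y y : ℂ)) =ᶠ[𝓝 x] fun y : ℝ =>
      ∑' n, c n * fourier n (y : AddCircle (2 : ℝ)) := by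
    filter_upwards [isOpen_Ioo.mem_nhds hxI] with y hy
    rw [← evenCircle_coe hy]
    exact (hser y).tsum_eq.symm
  have h3 := h1.unique ((hder x).congr_of_eventuallyEq h2)
  have h4 := tsum_of_norm_bounded hsη (fun n => hbd n x)
  rw [← h3, Complex.norm_real, norm_mul, Real.norm_of_nonneg (hYpos x).le, norm_div, norm_neg] at h4
  have h5 := (abs_le.1 (hclose x hxI)).1
  have h6 : 1 / 2 * (‖f x‖ / 2) ≤ Y x * (‖f x‖ / 2) := by gcongr; linarith
  rw [Real.norm_ofNat] at h4
  linarith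

lemma integral_cos_int_mul_pi {n : ℤ} (hn : n ≠ 0) :
    ∫ x in (0 : ℝ)..1, Real.cos (n * Real.pi * x) = 0 := by
  have h0 : (n * Real.pi : ℝ) ≠ 0 := mul_ne_zero (by exact_mod_cast hn) Real.pi_ne_zero
  rw [intervalIntegral.integral_comp_mul_left _ h0]
  simp [Real.sin_int_mul_pi]

/-- If the Cole-Hopf transform of the initial datum is close to `1` in `L¹(0,1)`, the solution is
small at time `T`. -/
lemma PotentialSolution.norm_le {T : ℝ} (hT : 0 < T) {φ φx : ℝ → L2I}
    (hφ : PotentialSolution T φ φx) {η : ℝ}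
    (hη : ∫ x in (0 : ℝ)..1, |Real.exp (-(primitive (φ 0) x) / 2) - 1| ≤ η)
    (hη1 : η ≤ 1 / 2) (hη2 : heatConstant T * (2 * η) ≤ 1 / 2) :
    ‖φ T‖ ≤ 8 * heatConstant T * η := by
  set P := primitive (φ 0) with hP
  have hPc : Continuous P := continuous_primitive _
  have hη0 : 0 ≤ η :=
    (intervalIntegral.integral_nonneg zero_le_one fun x _ => abs_nonneg _).trans hη
  have hmom : ∀ k : ℝ → ℝ, Continuous k → (∀ x, |k x| ≤ 1) →
      |expMoment k P - ∫ x in (0 : ℝ)..1, k x| ≤ η := by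
    intro k hk hk1
    refine le_trans ?_ hη
    rw [expMoment, ← intervalIntegral.integral_sub (intervalIntegrable_exp_mul hk hPc)
      (hk.intervalIntegrable _ _), ← Real.norm_eq_abs]
    refine intervalIntegral.norm_integral_le_of_norm_le zero_le_one (ae_of_all _ fun x _ => ?_)
      (Continuous.intervalIntegrable (by fun_prop) _ _)
    rw [show Real.exp (-(P x) / 2) * k x - k x = (Real.exp (-(P x) / 2) - 1) * k x by ring,
      norm_mul]
    exact mul_le_of_le_one_right (norm_nonneg _) (hk1 x)
  have hm : 1 / 2 ≤ expMoment (fun _ => 1) P := by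
    have := (abs_le.1 (hmom (fun _ => 1) continuous_const (by simp))).1
    simp only [intervalIntegral.integral_const, sub_zero, smul_eq_mul, mul_one] at this
    linarith
  -- The denominator of the initial moments is at least `1/2`, whence `2 * η`.
  have h := norm_le_of_expMean_le (f := φ T) hT (by positivity : 0 ≤ 2 * η) hη2 fun n hn => by
    have hd : ∀ x : ℝ, HasDerivAt (fun x : ℝ => n * Real.pi * x) (n * Real.pi) x := fun x => by
      simpa using (hasDerivAt_id x).const_mul (n * Real.pi : ℝ)
    have e := hφ.expMean_eq hT (k := fun x => Real.cos (n * Real.pi * x))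
      (k' := fun x => -(n * Real.pi) * Real.sin (n * Real.pi * x)) (l := (n * Real.pi) ^ 2)
      (fun x => (hd x).cos.congr_deriv (by ring))
      (fun x => ((hd x).sin.const_mul _).congr_deriv (by ring)) (by simp)
      (by simp [Real.sin_int_mul_pi]) (fun x _ => Real.abs_cos_le_one _)
    rw [e, abs_mul, Real.abs_exp]
    gcongr
    have h1 := hmom (fun x => Real.cos (n * Real.pi * x)) (by fun_prop)
      fun x => Real.abs_cos_le_one _
    rw [integral_cos_int_mul_pi hn, sub_zero] at h1
    rw [expMean, abs_div, abs_of_pos (by linarith : 0 < expMoment (fun _ => 1) P),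
      div_le_iff₀ (by linarith)]
    calc _ ≤ η := h1
      _ = 2 * η * (1 / 2) := by ring
      _ ≤ _ := by gcongr
  linarith

/-! ### The boundary residue -/

lemma abs_tanh_sub_one_le (y : ℝ) : |Real.tanh y - 1| ≤ 2 * Real.exp (-(2 * y)) := by
  have hp := Real.exp_pos y
  have hn := Real.exp_pos (-y)
  have e : Real.tanh y - 1 = -(2 * Real.exp (-y) / (Real.exp y + Real.exp (-y))) := by
    rw [Real.tanh_eq]
    field_simp
    ring
  rw [e, abs_neg, abs_of_pos (by positivity), div_le_iff₀ (by positivity), mul_add,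
    show -(2 * y) = -y + -y by ring, Real.exp_add]
  have e2 : Real.exp (-y) * Real.exp y = 1 := by rw [← Real.exp_add]; simp
  have : 0 < Real.exp (-y) * Real.exp (-y) * Real.exp (-y) := by positivity
  calc 2 * Real.exp (-y) = 2 * (Real.exp (-y) * (Real.exp (-y) * Real.exp y)) := by rw [e2]; ring
    _ ≤ _ := by linarith

lemma continuous_boundaryResidue (H ε : ℝ) : Continuous (boundaryResidue H ε) := by
  unfold boundaryResidue
  have h : Continuous Real.tanh := by
    rw [show Real.tanh = fun x => Real.sinh x / Real.cosh x from
      funext Real.tanh_eq_sinh_div_cosh]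
    exact Real.continuous_sinh.div Real.continuous_cosh fun x => (Real.cosh_pos x).ne'
  fun_prop

section Residue

variable {H ε : ℝ}

/-- The boundary layer profile. -/
def layerProfile (H ε x : ℝ) : ℝ := Real.exp (H / ε * (x - 1))

lemma hasDerivAt_layerProfile (H ε x : ℝ) :
    HasDerivAt (layerProfile H ε) (H / ε * layerProfile H ε x) x := by
  have := (((hasDerivAt_id x).sub_const 1).const_mul (H / ε)).exp
  exact this.congr_deriv (by simp [layerProfile]; ring)

lemma continuous_layerProfile (H ε : ℝ) : Continuous (layerProfile H ε) := by
  unfold layerProfile; fun_prop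

lemma integral_layerProfile (H ε a b : ℝ) :
    ∫ x in a..b, H / ε * layerProfile H ε x = layerProfile H ε b - layerProfile H ε a :=
  intervalIntegral.integral_eq_sub_of_hasDerivAt (fun x _ => hasDerivAt_layerProfile H ε x)
    (((continuous_layerProfile H ε).const_mul _).intervalIntegrable _ _)

lemma layerProfile_pos (H ε x : ℝ) : 0 < layerProfile H ε x := Real.exp_pos _

lemma layerProfile_le_one (hH : 0 < H) (hε : 0 < ε) {x : ℝ} (hx : x ≤ 1) :
    layerProfile H ε x ≤ 1 := by
  rw [layerProfile, Real.exp_le_one_iff]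
  exact mul_nonpos_of_nonneg_of_nonpos (by positivity) (by linarith)

/-- The tail bound for `tanh` dominates the residue by `2 (H/ε) e^{H(y-1)/ε}`, which is the
derivative of twice the layer profile. -/
lemma abs_integral_boundaryResidue_le (hH : 0 < H) (hε : 0 < ε) {x : ℝ} (hx : 0 ≤ x) :
    |∫ y in (0 : ℝ)..x, boundaryResidue H ε y| ≤ 2 * layerProfile H ε x := by
  have h := intervalIntegral.norm_integral_le_of_norm_le hx (μ := volume)
    (f := boundaryResidue H ε) (g := fun y => 2 * (H / ε * layerProfile H ε y))
    (ae_of_all _ fun y _ => by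
      rw [boundaryResidue, norm_mul, Real.norm_of_nonneg (by positivity)]
      calc _ ≤ H / ε * (2 * Real.exp (-(2 * (H / (2 * ε) * (1 - y))))) := by
            gcongr; exact abs_tanh_sub_one_le _
        _ = 2 * (H / ε * Real.exp (H / ε * (y - 1))) := by
            rw [show -(2 * (H / (2 * ε) * (1 - y))) = H / ε * (y - 1) by field_simp; ring]
            ring)
    (Continuous.intervalIntegrable
      (((continuous_layerProfile H ε).const_mul _).const_mul _) _ _)
  rw [intervalIntegral.integral_const_mul, integral_layerProfile] at h
  have := layerProfile_pos H ε 0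
  rw [← Real.norm_eq_abs]
  linarith

/-- The exponential is Lipschitz on the bounded range of the primitive, so the `L¹` distance to `1`
is governed by the mass of the layer, at most `ε/H`, and by `‖d‖/ε`. -/
lemma integral_abs_exp_primitive_sub_one_le (hH : 0 < H) (hε : 0 < ε) {f d : L2I}
    (hf : ∀ᵐ x ∂unitVol, f x = boundaryResidue H ε x + 1 / ε * d x) (hd : ‖d‖ / ε ≤ 1) :
    ∫ x in (0 : ℝ)..1, |Real.exp (-(primitive f x) / 2) - 1|
      ≤ Real.exp (3 / 2) * (2 * (ε / H) + ‖d‖ / ε) := by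
  have hP : ∀ x ∈ Icc (0 : ℝ) 1,
      |primitive f x| ≤ 2 * layerProfile H ε x + ‖d‖ / ε := by
    intro x hx
    have hfz : ∀ᵐ y ∂unitVol, f y = boundaryResidue H ε y + 1 / ε * zeroExt d y := by
      filter_upwards [hf, ae_unitVol_iff.2 (ae_of_all _ fun x hx => hx)] with y hy hyI
      rw [hy, zeroExt_eq hyI]
    rw [primitive_congr hfz hx, intervalIntegral.integral_add
      ((continuous_boundaryResidue H ε).intervalIntegrable _ _)
      ((integrable_zeroExt d).const_mul _).intervalIntegrable,
      intervalIntegral.integral_const_mul]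
    refine (abs_add_le _ _).trans (add_le_add (abs_integral_boundaryResidue_le hH hε hx.1) ?_)
    rw [abs_mul, abs_of_pos (by positivity), one_div, inv_mul_eq_div]
    gcongr
    exact abs_primitive_le d x
  have hle : ∫ x in (0 : ℝ)..1, |Real.exp (-(primitive f x) / 2) - 1|
      ≤ ∫ x in (0 : ℝ)..1, Real.exp (3 / 2) * (2 * (ε / H) * (H / ε * layerProfile H ε x)
          + ‖d‖ / ε) := by
    have hc := continuous_layerProfile H ε
    refine intervalIntegral.integral_mono_on zero_le_one
      (Continuous.intervalIntegrable (by fun_prop) _ _)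
      (Continuous.intervalIntegrable (by fun_prop) _ _) fun x hx => ?_
    have h1 := hP x hx
    have h2 := layerProfile_le_one hH hε hx.2
    -- `R = 3` since the primitive is at most `2 · 1 + 1` in absolute value.
    have h3 := abs_exp_sub_exp_le (a := primitive f x) (b := 0) (R := 3) (by linarith) (by simp)
    simp only [neg_zero, zero_div, Real.exp_zero, sub_zero] at h3
    refine h3.trans ?_
    gcongr
    refine h1.trans (le_of_eq ?_)
    field_simp
  refine hle.trans ?_
  have hc := continuous_layerProfile H ε
  rw [intervalIntegral.integral_const_mul, intervalIntegral.integral_add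
    (Continuous.intervalIntegrable (by fun_prop) _ _) intervalIntegrable_const,
    intervalIntegral.integral_const_mul, integral_layerProfile]
  simp only [intervalIntegral.integral_const, sub_zero, smul_eq_mul, one_mul]
  gcongr _ * (?_ + _)
  refine mul_le_of_le_one_right (by positivity) ?_
  have := layerProfile_le_one hH hε le_rfl
  have := layerProfile_pos H ε 0
  linarith

end Residue

/-! ### The final estimates in `ε`. -/

/-- Dissipation of the perturbed boundary residue, at the rate `O(ε)`. -/
lemma norm_isBigO_of_boundaryResidue {T H : ℝ} (hT : 0 < T) (hH : 0 < H) {d : ℝ → L2I}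
    (hd : (fun ε : ℝ => ‖d ε‖) =O[𝓝[>] (0 : ℝ)] fun ε : ℝ => ε ^ 3) {φ : ℝ → ℝ → L2I}
    (hφ : ∀ᶠ ε in 𝓝[>] (0 : ℝ),
      IsBurgersSolution T (fun x => boundaryResidue H ε x + 1 / ε * d ε x) (φ ε)) :
    (fun ε : ℝ => ‖φ ε T‖) =O[𝓝[>] (0 : ℝ)] fun ε : ℝ => ε := by
  obtain ⟨K, hK0, hK⟩ := hd.exists_pos
  set S := heatConstant T with hS
  have hSpos : 0 < S := heatConstant_pos hT
  set C := Real.exp (3 / 2) * (2 / H + K) with hC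
  have hCpos : 0 < C := by positivity
  have hsmall : ∀ c : ℝ, ∀ b > 0, ∀ᶠ ε in 𝓝[>] (0 : ℝ), c * ε < b := fun c b hb => by
    have : Tendsto (fun ε : ℝ => c * ε) (𝓝 0) (𝓝 0) := by
      simpa using (continuous_const_mul c).tendsto (0 : ℝ)
    exact (this.mono_left nhdsWithin_le_nhds).eventually_lt_const hb
  refine IsBigO.of_bound (8 * S * C) ?_
  filter_upwards [hφ, hK.bound, hsmall 1 1 one_pos, hsmall K 1 one_pos,
    hsmall C (1 / 2) (by norm_num), hsmall (S * (2 * C)) (1 / 2) (by norm_num),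
    self_mem_nhdsWithin] with ε hsol hdε h1 hKε hCε hSε hε
  have hε : 0 < ε := hε
  obtain ⟨φx, hpot⟩ := hsol.exists_potentialSolution
  have hdε' : ‖d ε‖ / ε ≤ K * ε := by
    rw [div_le_iff₀ hε]
    simp only [norm_norm, norm_pow, Real.norm_of_nonneg hε.le] at hdε
    refine hdε.trans ?_
    -- One power of `ε` is given away: `‖d‖/ε = O(ε)` already matches the contribution of the layer.
    have : ε ^ 3 ≤ ε ^ 2 := pow_le_pow_of_le_one hε.le (by linarith) (by norm_num)
    calc K * ε ^ 3 ≤ K * ε ^ 2 := by gcongr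
      _ = _ := by ring
  have hη : ∫ x in (0 : ℝ)..1, |Real.exp (-(primitive (φ ε 0) x) / 2) - 1| ≤ C * ε := by
    refine (integral_abs_exp_primitive_sub_one_le hH hε hsol.2.1 (by linarith)).trans ?_
    calc _ ≤ Real.exp (3 / 2) * (2 * (ε / H) + K * ε) := by gcongr
      _ = C * ε := by rw [hC]; ring
  have := hpot.norm_le hT hη hCε.le (by rw [← hS]; linarith)
  rw [norm_norm, Real.norm_of_nonneg hε.le]
  linarith

lemma isBigO_rpow_one_sub {δ : ℝ} (hδ : 0 < δ) :
    (fun ε : ℝ => ε) =O[𝓝[>] (0 : ℝ)] fun ε : ℝ => ε ^ (1 - δ) := by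
  refine IsBigO.of_bound 1 ?_
  filter_upwards [Ioo_mem_nhdsGT one_pos] with ε hε
  rw [Real.norm_of_nonneg hε.1.le, Real.norm_of_nonneg (Real.rpow_nonneg hε.1.le _), one_mul]
  calc ε = ε ^ (1 : ℝ) := (Real.rpow_one ε).symm
    _ ≤ ε ^ (1 - δ) := Real.rpow_le_rpow_of_exponent_ge hε.1 hε.2.le (by linarith)

end

theorem mainTheorem5 (T H : ℝ) (hT : 0 < T) (hH : 0 < H) :
    -- dissipation of the boundary residue
    (∀ φ : ℝ → ℝ → L2I,
      (∀ᶠ ε in 𝓝[>] (0 : ℝ), IsBurgersSolution T (boundaryResidue H ε) (φ ε)) →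
      ∀ δ : ℝ, 0 < δ →
        (fun ε : ℝ => ‖φ ε T‖) =O[𝓝[>] (0 : ℝ)] (fun ε : ℝ => ε ^ (1 - δ))) ∧
    -- dissipation of the perturbed boundary residue `Φ^ε + d^ε / ε`
    (∀ d : ℝ → L2I,
      (∀ᶠ ε in 𝓝[>] (0 : ℝ), ∀ᵐ x ∂unitVol, boundaryResidue H ε x + 1 / ε * d ε x ≤ 0) →
      ((fun ε : ℝ => ‖d ε‖) =O[𝓝[>] (0 : ℝ)] (fun ε : ℝ => ε ^ 3)) →
      ∀ φ : ℝ → ℝ → L2I,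
        (∀ᶠ ε in 𝓝[>] (0 : ℝ),
          IsBurgersSolution T (fun x => boundaryResidue H ε x + 1 / ε * d ε x) (φ ε)) →
        ∀ δ : ℝ, 0 < δ →
          (fun ε : ℝ => ‖φ ε T‖) =O[𝓝[>] (0 : ℝ)] (fun ε : ℝ => ε ^ (1 - δ))) := by
  refine ⟨fun φ hφ δ hδ => ?_, fun d _ hd φ hφ δ hδ =>
    (norm_isBigO_of_boundaryResidue hT hH hd hφ).trans (isBigO_rpow_one_sub hδ)⟩
  -- The unperturbed residue is the case `d = 0`; the initial datum changes only on a null set.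
  refine (norm_isBigO_of_boundaryResidue hT hH (d := fun _ => 0) ?_ ?_).trans
    (isBigO_rpow_one_sub hδ)
  · simpa using isBigO_zero _ _
  · filter_upwards [hφ] with ε h
    refine ⟨h.1, ?_, h.2.2⟩
    filter_upwards [h.2.1, Lp.coeFn_zero ℝ 2 unitVol] with x hx h0
    rw [hx, h0]
    simp
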